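/- Let $N$ be an odd integer with $n \ge 2$ distinct prime factors and bit length $m$, let $c \ge 1$ be a real number, let $k \ge 1$ be an integer, and let $\log$ be the logarithm to base two. Consider the following algorithm. (1) Select $g$ uniformly at random from $\mathbb{Z}_N^*$ and obtain its order $r$ by a single order finding call. (2) Let $m' = cm$ and compute $r' = r \prod_{q \le m',\, q \text{ prime}} q^{\eta(q, m')}$, where $\eta(q, m')$ is the largest integer with $q^{\eta(q, m')} \le m'$. Write $r' = 2^t o$ with $o$ odd. (3) For $j = 1, \ldots, k$, select $x_j$ uniformly at random from $\mathbb{Z}_N^*$, independently of all other choices, and for $i = 0, \ldots, t$ compute $d_{i,j} = \gcd(x_j^{2^i o} - 1, N)$; if $1 < d_{i,j} < N$, report $d_{i,j}$. (4) Maintain a set of integers, initially $\{N\}$, to which every reported number is added. The set is kept reduced: as long as two distinct elements $a, b$ have $\gcd(a, b) = d \ne 1$, they are replaced by those of $d$, $a/d$, $b/d$ that differ from $1$; and if an element is a perfect power $q^e$ with $e \ge 2$, then $q$ is added to the set. The set is reduced when its elements are pairwise coprime and none of them is a perfect power; it is brought into this form at the start and after each addition of a reported number. Then: (a) The part of the algorithm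 other than the order finding call runs in polynomial time. Precisely, there are a fixed program (on a machine with finitely many integer variables and stacks, whose steps are counted in bit operations) and absolute constants $C, D$ such that, on input $N$, $r$, $\lfloor cm \rfloor$, $k$ and $x_1, \ldots, x_k$, the program always halts after at most $C (c m k)^D$ steps, and its output is a final set of the algorithm. In particular, the running time is polynomial in $m$ and $k$ for every constant $c$. (b) The algorithm completely factors $N$, that is, its final set is exactly the set of the distinct prime factors of $N$, whatever the order of the reduction steps in (4), except with probability at most $$2^{-k} \binom{n}{2} + \frac{1}{2 c^2 \log^2 (cm)}.$$ The probability is over the uniform and independent choices of $g, x_1, \ldots, x_k$. -/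

import Mathlib

namespace OrderFactoring

/-! ### The factoring algorithm -/

/-- `r' = r * ∏ q ^ η(q, B)`, the product being over the primes `q ≤ B`; here `η(q, B) = Nat.log q B`
is the largest integer with `q ^ η(q, B) ≤ B`. For a real bound `m'` the primes `q ≤ m'` and the
exponents `η(q, m')` are those of `B = ⌊m'⌋`. -/
def grownOrder (r B : ℕ) : ℕ :=
  r * ∏ q ∈ (Finset.range (B + 1)).filter Nat.Prime, q ^ Nat.log q B

/-- The exponent `t` in `r' = 2 ^ t * o` with `o` odd. -/
def twoExponent (r' : ℕ) : ℕ := padicValNat 2 r'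

/-- The odd part `o` in `r' = 2 ^ t * o`. -/
def oddPart (r' : ℕ) : ℕ := r' / 2 ^ twoExponent r'

/-- `gcd (x ^ (2 ^ i * o) - 1, N)`. -/
def trialGcd (N o x i : ℕ) : ℕ := Int.gcd ((x : ℤ) ^ (2 ^ i * o) - 1) (N : ℤ)

/-- The non-trivial factors reported by the main loop, in order: for each `x` of the list `xs` and
each `i = 0, …, t`, the number `gcd (x ^ (2 ^ i * o) - 1, N)` if it lies strictly between `1`
and `N`. -/
def reports (N r B : ℕ) (xs : List ℕ) : List ℕ :=
  xs.flatMap fun x =>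
    ((List.range (twoExponent (grownOrder r B) + 1)).map
      (trialGcd N (oddPart (grownOrder r B)) x)).filter fun d => 1 < d ∧ d < N

/-- One step in reducing a set of factors: either two distinct elements `a`, `b` with
`g = gcd (a, b) ≠ 1` are replaced by those of `g`, `a / g`, `b / g` that are not `1`, or an element
is found to be a perfect power `q ^ e`, `e ≥ 2`, and `q` is added to the set. -/
inductive ReduceStep : Finset ℕ → Finset ℕ → Prop
  | split (S : Finset ℕ) (a b : ℕ) (ha : a ∈ S) (hb : b ∈ S) (hab : a ≠ b) (hg : a.gcd b ≠ 1) :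
      ReduceStep S
        ((((S.erase a).erase b) ∪ {a.gcd b, a / a.gcd b, b / a.gcd b}).erase 1)
  | root (S : Finset ℕ) (q e : ℕ) (he : 2 ≤ e) (hq : q ^ e ∈ S) :
      ReduceStep S (insert q S)

/-- The elements of `S` are pairwise coprime and none of them is a perfect power. -/
def IsReduced (S : Finset ℕ) : Prop :=
  (∀ a ∈ S, ∀ b ∈ S, a ≠ b → a.Coprime b) ∧ ∀ a ∈ S, ∀ q e : ℕ, 2 ≤ e → a ≠ q ^ e

/-- `S` is turned into the reduced set `T` by finitely many reduction steps. -/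
def ReducesTo (S T : Finset ℕ) : Prop := Relation.ReflTransGen ReduceStep S T ∧ IsReduced T

/-- Starting from the set `S`, the reported factors are added one after the other, the set being
reduced after each addition, and the final set is `T`. -/
def Absorbs : List ℕ → Finset ℕ → Finset ℕ → Prop
  | [], S, T => T = S
  | d :: ds, S, T => ∃ S' : Finset ℕ, ReducesTo (insert d S) S' ∧ Absorbs ds S' T

/-- `T` is a possible final set of the factoring algorithm on `N`, where `r` is the result of the
order finding call, `B` is the integral part of the bound `m'` on the prime powers, and `xs` are the
elements selected in the iterations. (The order in which the reduction steps are made is left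
open.) -/
def FactoringRun (N r B : ℕ) (xs : List ℕ) (T : Finset ℕ) : Prop :=
  ∃ S : Finset ℕ, ReducesTo {N} S ∧ Absorbs (reports N r B xs) S T

/-! ### Programs and their running time in bit operations -/

/-- The memory of the machine: variables that hold natural numbers, and stacks of natural
numbers. -/
structure Store where
  var : ℕ → ℕ
  stack : ℕ → List ℕ

/-- The arithmetic instructions (subtraction is truncated, division is rounded down). -/
inductive ArithOp
  | add | sub | mul | div | mod

def ArithOp.eval : ArithOp → ℕ → ℕ → ℕ
  | .add, a, b => a + b
  | .sub, a, b => a - b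
  | .mul, a, b => a * b
  | .div, a, b => a / b
  | .mod, a, b => a % b

/-- Programs. The numbers `x`, `y`, `z` name variables, and `s` names a stack. -/
inductive Prog
  | skip
  | const (x n : ℕ)
  | arith (op : ArithOp) (x y z : ℕ)
  | size (x y : ℕ)
  | push (s x : ℕ)
  | pop (x s : ℕ)
  | seq (p q : Prog)
  | ifPos (x : ℕ) (p q : Prog)
  | loop (x : ℕ) (p : Prog)

/-- The store after a run of the program. `size x y` puts the bit length of `y` into `x`; `pop x s`
moves the top of the stack `s` to `x` (`0` if `s` is empty); `loop x p` runs `p` as many times as the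
value of `x` on entry says. -/
def Prog.run : Prog → Store → Store
  | .skip, σ => σ
  | .const x n, σ => { σ with var := Function.update σ.var x n }
  | .arith op x y z, σ =>
      { σ with var := Function.update σ.var x (op.eval (σ.var y) (σ.var z)) }
  | .size x y, σ => { σ with var := Function.update σ.var x (Nat.size (σ.var y)) }
  | .push s x, σ => { σ with stack := Function.update σ.stack s (σ.var x :: σ.stack s) }
  | .pop x s, σ =>
      { var := Function.update σ.var x ((σ.stack s).headD 0)
        stack := Function.update σ.stack s (σ.stack s).tail }
  | .seq p q, σ => q.run (p.run σ)
  | .ifPos x p q, σ => if 0 < σ.var x then p.run σ else q.run σ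
  | .loop x p, σ => p.run^[σ.var x] σ

/-- The number of steps of a run: moving or testing a number costs its bit length plus one,
an arithmetic instruction costs what the schoolbook method takes, and each pass through a loop costs
one step more than its body. -/
def Prog.cost : Prog → Store → ℕ
  | .skip, _ => 1
  | .const _ n, _ => 1 + Nat.size n
  | .arith _ _ y z, σ => (1 + Nat.size (σ.var y)) * (1 + Nat.size (σ.var z))
  | .size _ y, σ => 1 + Nat.size (σ.var y)
  | .push _ x, σ => 1 + Nat.size (σ.var x)
  | .pop _ s, σ => 1 + Nat.size ((σ.stack s).headD 0)
  | .seq p q, σ => p.cost σ + q.cost (p.run σ)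
  | .ifPos x p q, σ => 1 + Nat.size (σ.var x) + if 0 < σ.var x then p.cost σ else q.cost σ
  | .loop x p, σ =>
      1 + Nat.size (σ.var x) + ∑ i ∈ Finset.range (σ.var x), (1 + p.cost (p.run^[i] σ))

/-- The initial store: `N`, `r`, `B` and the number of the `xs` are in the variables `0, 1, 2, 3`,
the `xs` are on the stack `0`, and everything else is zero or empty. -/
def inputStore (N r B : ℕ) (xs : List ℕ) : Store where
  var := fun i => [N, r, B, xs.length].getD i 0
  stack := fun s => if s = 0 then xs else []

/-- The set of the numbers on the stack `1` after a run. -/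
def Prog.output (P : Prog) (N r B : ℕ) (xs : List ℕ) : Finset ℕ :=
  ((P.run (inputStore N r B xs)).stack 1).toFinset

/-- The number of steps on the given input. -/
def Prog.time (P : Prog) (N r B : ℕ) (xs : List ℕ) : ℕ :=
  P.cost (inputStore N r B xs)

/-! ### Random choices -/

/-- The representatives in `[0, N)` of the elements `x 0, …, x (k - 1)` of `Z_N^*`. -/
def representatives {N k : ℕ} (x : Fin k → (ZMod N)ˣ) : List ℕ :=
  List.ofFn fun j => (x j : ZMod N).val

/-- The probability of the event `E` for the uniform distribution on the finite type `Ω`. -/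
noncomputable def uniformProb {Ω : Type*} (E : Set Ω) : ℝ := (E.ncard : ℝ) / (Nat.card Ω : ℝ)

end OrderFactoring

namespace OrderFactoring

/-! Correctness. Every reduction step keeps the old elements as products of new ones, so `N` and all
reports are products of elements of the final set `T`. As `T` is pairwise coprime, two primes that
divide the same element of `T` divide the same reports (`IsReduced.dvd_of_dvd`). Hence if every pair
of prime factors of `N` is separated, meaning that some report is divisible by exactly one of the
two, each element of `T` is a prime power, and then a prime because it is no perfect power
(`FactoringRun.eq_primeFactors`).

Probability. Let `M = cm`, and fix two prime factors `p`, `p'`. By the Chinese remainder theorem the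
reductions of a uniform unit modulo `p` and `p'` are independent and uniform. If `p - 1` does not
divide `r'`, the order of `g` modulo `p` misses a prime power `q ^ (η + 1) > M` that divides `p -
1`. In a cyclic group this has probability at most `1 / M` for each `q`, and at most `log p / log M`
primes `q` qualify (`uniformProb_missedSet_le`). So both primes go wrong with probability at most `ε
p * ε p'`, where `ε p = log p / (M log M)`. If at least one of `p - 1`, `p' - 1` divides `r'`, each
`x_j` fails to separate the pair with probability at most 1/2 (`exists_mul_not_separated`). A union
bound over pairs gives the binomial term, and the sum of `ε p * ε p'` over pairs is at most half the
square of the sum of all `ε p`, which is at most `1 / (c log M)` because the sum of the `log p` is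
at most `m`.

Running time. `Prog.Good Z` asserts a run whose operands have at most `Z` bits and whose loops make
at most `Z` passes. Induction on the program turns this into a cost of at most `C (Z + 2) ^ D`, with
constants that depend on the program alone (`Prog.exists_cost_le`). It remains to specify one
program with `Z = 10 B² k`, `B = ⌊cm⌋`. Its reduction loop ends because each effective step at least
halves the product of the list (`prod_stepList_le`), and it needs no primality tests because the
product of prime powers in `r'` is the least common multiple of `1, …, B` (`grownOrder_eq`). -/

/-! ### A program logic with resource bounds -/

/-- Assignment to a variable. -/
def Store.set (σ : Store) (x v : ℕ) : Store := { σ with var := Function.update σ.var x v }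

/-- Replacement of a stack. -/
def Store.setStack (σ : Store) (s : ℕ) (l : List ℕ) : Store :=
  { σ with stack := Function.update σ.stack s l }

@[simp] theorem Store.set_var (σ : Store) (x v y : ℕ) :
    (σ.set x v).var y = if y = x then v else σ.var y := by
  simp [Store.set, Function.update_apply]

@[simp] theorem Store.set_stack (σ : Store) (x v : ℕ) : (σ.set x v).stack = σ.stack := rfl

@[simp] theorem Store.setStack_var (σ : Store) (s : ℕ) (l : List ℕ) :
    (σ.setStack s l).var = σ.var := rfl

@[simp] theorem Store.setStack_stack (σ : Store) (s : ℕ) (l : List ℕ) (t : ℕ) :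
    (σ.setStack s l).stack t = if t = s then l else σ.stack t := by
  simp [Store.setStack, Function.update_apply]

/-- `P.Good Z Q σ`: started in `σ`, the program `P` reaches a store that satisfies `Q`, all
operands on the way being less than `2 ^ Z` and all loops making at most `Z` passes. -/
def Prog.Good (Z : ℕ) : Prog → (Store → Prop) → Store → Prop
  | .skip, Q, σ => Q σ
  | .const x n, Q, σ => Q (σ.set x n)
  | .arith op x y z, Q, σ =>
      σ.var y < 2 ^ Z ∧ σ.var z < 2 ^ Z ∧ Q (σ.set x (op.eval (σ.var y) (σ.var z)))
  | .size x y, Q, σ => σ.var y < 2 ^ Z ∧ Q (σ.set x (Nat.size (σ.var y)))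
  | .push s x, Q, σ => σ.var x < 2 ^ Z ∧ Q (σ.setStack s (σ.var x :: σ.stack s))
  | .pop x s, Q, σ => (σ.stack s).headD 0 < 2 ^ Z ∧
      Q ((σ.set x ((σ.stack s).headD 0)).setStack s (σ.stack s).tail)
  | .seq p q, Q, σ => p.Good Z (q.Good Z Q) σ
  | .ifPos x p q, Q, σ =>
      σ.var x < 2 ^ Z ∧ (0 < σ.var x → p.Good Z Q σ) ∧ (σ.var x = 0 → q.Good Z Q σ)
  | .loop x p, Q, σ => σ.var x ≤ Z ∧ ∃ I : ℕ → Store → Prop, I 0 σ ∧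
      (∀ i < σ.var x, ∀ τ, I i τ → p.Good Z (I (i + 1)) τ) ∧ ∀ τ, I (σ.var x) τ → Q τ

section simpLemmas
variable (Z : ℕ) (Q : Store → Prop) (σ : Store)

@[simp] theorem good_skip : Prog.skip.Good Z Q σ ↔ Q σ := Iff.rfl

@[simp] theorem good_const (x n : ℕ) : (Prog.const x n).Good Z Q σ ↔ Q (σ.set x n) := Iff.rfl

@[simp] theorem good_arith (op : ArithOp) (x y z : ℕ) : (Prog.arith op x y z).Good Z Q σ ↔
    σ.var y < 2 ^ Z ∧ σ.var z < 2 ^ Z ∧ Q (σ.set x (op.eval (σ.var y) (σ.var z))) := Iff.rfl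

@[simp] theorem good_size (x y : ℕ) : (Prog.size x y).Good Z Q σ ↔
    σ.var y < 2 ^ Z ∧ Q (σ.set x (Nat.size (σ.var y))) := Iff.rfl

@[simp] theorem good_push (s x : ℕ) : (Prog.push s x).Good Z Q σ ↔
    σ.var x < 2 ^ Z ∧ Q (σ.setStack s (σ.var x :: σ.stack s)) := Iff.rfl

@[simp] theorem good_pop (x s : ℕ) : (Prog.pop x s).Good Z Q σ ↔
    (σ.stack s).headD 0 < 2 ^ Z ∧
      Q ((σ.set x ((σ.stack s).headD 0)).setStack s (σ.stack s).tail) := Iff.rfl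

@[simp] theorem good_seq (p q : Prog) :
    (Prog.seq p q).Good Z Q σ ↔ p.Good Z (q.Good Z Q) σ := Iff.rfl

@[simp] theorem good_ifPos (x : ℕ) (p q : Prog) : (Prog.ifPos x p q).Good Z Q σ ↔
    σ.var x < 2 ^ Z ∧ (0 < σ.var x → p.Good Z Q σ) ∧ (σ.var x = 0 → q.Good Z Q σ) := Iff.rfl

@[simp] theorem eval_add (a b : ℕ) : ArithOp.add.eval a b = a + b := rfl
@[simp] theorem eval_sub (a b : ℕ) : ArithOp.sub.eval a b = a - b := rfl
@[simp] theorem eval_mul (a b : ℕ) : ArithOp.mul.eval a b = a * b := rfl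
@[simp] theorem eval_div (a b : ℕ) : ArithOp.div.eval a b = a / b := rfl
@[simp] theorem eval_mod (a b : ℕ) : ArithOp.mod.eval a b = a % b := rfl

end simpLemmas

theorem good_loop {Z x : ℕ} {p : Prog} {Q : Store → Prop} {σ : Store} (I : ℕ → Store → Prop)
    (hx : σ.var x ≤ Z) (h0 : I 0 σ)
    (hs : ∀ i < σ.var x, ∀ τ, I i τ → p.Good Z (I (i + 1)) τ)
    (hQ : ∀ τ, I (σ.var x) τ → Q τ) : (Prog.loop x p).Good Z Q σ :=
  ⟨hx, I, h0, hs, hQ⟩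

/-- A loop that makes one pass for each element of a list. -/
theorem good_loop_list {Z x : ℕ} {p : Prog} {Q : Store → Prop} {σ : Store} (l : List ℕ)
    (I : List ℕ → List ℕ → Store → Prop) (hl : σ.var x = l.length) (hx : l.length ≤ Z)
    (h0 : I [] l σ)
    (hs : ∀ pre a suf, l = pre ++ a :: suf → ∀ τ, I pre (a :: suf) τ →
      p.Good Z (I (pre ++ [a]) suf) τ)
    (hQ : ∀ τ, I l [] τ → Q τ) : (Prog.loop x p).Good Z Q σ := by
  refine good_loop (fun i τ => I (l.take i) (l.drop i) τ) (by omega) (by simpa using h0) ?_ ?_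
  · intro i hi τ h
    rw [hl] at hi
    have h1 : l.drop i = l[i] :: l.drop (i + 1) := List.drop_eq_getElem_cons hi
    have h2 : l.take (i + 1) = l.take i ++ [l[i]] := (List.take_append_getElem hi).symm
    rw [h1] at h
    simp only [h2]
    exact hs _ _ _ (by rw [← h1, List.take_append_drop]) τ h
  · intro τ h
    apply hQ
    simpa [hl] using h

/-- Induction on the program. In a loop the invariant supplied by `Good` is carried along the
iterates of the body. -/
theorem Prog.Good.sound {Z : ℕ} {P : Prog} : ∀ {Q : Store → Prop} {σ : Store},
    P.Good Z Q σ → Q (P.run σ) := by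
  induction P with
  | skip => exact fun h => h
  | const x n => exact fun h => h
  | arith op x y z => exact fun h => h.2.2
  | size x y => exact fun h => h.2
  | push s x => exact fun h => h.2
  | pop x s => exact fun h => h.2
  | seq p q hp hq => exact fun h => hq (hp h)
  | ifPos x p q hp hq =>
    intro Q σ h
    simp only [Prog.run]
    split_ifs with hx
    · exact hp (h.2.1 hx)
    · exact hq (h.2.2 (by omega))
  | loop x p hp =>
    rintro Q σ ⟨-, I, h0, hs, hQ⟩
    have key : ∀ i ≤ σ.var x, I i (p.run^[i] σ) := by
      intro i
      induction i with
      | zero => exact fun _ => h0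
      | succ i ih =>
        intro hi
        rw [Function.iterate_succ_apply']
        exact hp (hs i hi _ (ih (by omega)))
    exact hQ _ (key _ le_rfl)

/-- An operand below `2 ^ Z` has at most `Z` bits, so a basic instruction costs at most a constant
times `(Z + 2) ^ 2`. Composition and branching add constants and degrees, and a loop raises the
degree by one. The constants come from the text of the program, uniformly in `Z` and the store. -/
theorem Prog.exists_cost_le (P : Prog) : ∃ C D : ℕ, ∀ (Z : ℕ) (Q : Store → Prop) (σ : Store),
    P.Good Z Q σ → P.cost σ ≤ C * (Z + 2) ^ D := by
  have hsz : ∀ {a Z : ℕ}, a < 2 ^ Z → 1 + Nat.size a ≤ Z + 2 := fun h => by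
    have := Nat.size_le.2 h
    omega
  have hpow : ∀ (Z D E : ℕ), (Z + 2) ^ D ≤ (Z + 2) ^ (D + E) :=
    fun Z D E => Nat.pow_le_pow_right (by omega) (by omega)
  induction P with
  | skip => exact ⟨1, 0, fun _ _ _ _ => by simp [Prog.cost]⟩
  | const x n => exact ⟨1 + Nat.size n, 0, fun _ _ _ _ => by simp [Prog.cost]⟩
  | arith op x y z =>
    refine ⟨1, 2, fun Z Q σ h => ?_⟩
    simp only [Prog.cost, one_mul, pow_two]
    exact Nat.mul_le_mul (hsz h.1) (hsz h.2.1)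
  | size x y => exact ⟨1, 1, fun Z Q σ h => by simpa [Prog.cost] using hsz h.1⟩
  | push s x => exact ⟨1, 1, fun Z Q σ h => by simpa [Prog.cost] using hsz h.1⟩
  | pop x s => exact ⟨1, 1, fun Z Q σ h => by simpa [Prog.cost] using hsz h.1⟩
  | seq p q hp hq =>
    obtain ⟨C, D, hp⟩ := hp
    obtain ⟨C', D', hq⟩ := hq
    refine ⟨C + C', D + D', fun Z Q σ h => ?_⟩
    have h1 := hp Z _ σ h
    have h2 := hq Z _ _ (Prog.Good.sound (P := p) (Q := q.Good Z Q) h)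
    have h3 := Nat.mul_le_mul_left C (hpow Z D D')
    have h4 := Nat.mul_le_mul_left C' (hpow Z D' D)
    rw [add_comm D' D] at h4
    simp only [Prog.cost, add_mul]
    omega
  | ifPos x p q hp hq =>
    obtain ⟨C, D, hp⟩ := hp
    obtain ⟨C', D', hq⟩ := hq
    refine ⟨C + C' + 1, D + D' + 1, fun Z Q σ h => ?_⟩
    have h0 : 1 + Nat.size (σ.var x) ≤ (Z + 2) ^ 1 := by simpa using hsz h.1
    have h3 := Nat.mul_le_mul_left C (hpow Z D (D' + 1))
    have h4 := Nat.mul_le_mul_left C' (hpow Z D' (D + 1))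
    have h5 := hpow Z 1 (D + D')
    rw [show D' + (D + 1) = D + D' + 1 by ring] at h4
    rw [show 1 + (D + D') = D + D' + 1 by ring] at h5
    rw [← add_assoc] at h3
    simp only [Prog.cost, add_mul, one_mul]
    split_ifs with hx
    · have := hp Z _ σ (h.2.1 hx)
      omega
    · have := hq Z _ σ (h.2.2 (by omega))
      omega
  | loop x p hp =>
    obtain ⟨C, D, hp⟩ := hp
    refine ⟨C + 2, D + 1, fun Z Q σ h => ?_⟩
    obtain ⟨hx, I, h0, hs, hQ⟩ := h
    have key : ∀ i ≤ σ.var x, I i (p.run^[i] σ) := by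
      intro i
      induction i with
      | zero => exact fun _ => h0
      | succ i ih =>
        intro hi
        rw [Function.iterate_succ_apply']
        exact (hs i hi _ (ih (by omega))).sound
    have hsum : ∑ i ∈ Finset.range (σ.var x), (1 + p.cost (p.run^[i] σ)) ≤
        σ.var x * (1 + C * (Z + 2) ^ D) := by
      refine (Finset.sum_le_card_nsmul _ _ (1 + C * (Z + 2) ^ D) fun i hi => ?_).trans (by simp)
      have hi' := Finset.mem_range.1 hi
      exact Nat.add_le_add_left (hp Z _ _ (hs i hi' _ (key i hi'.le))) 1
    have h1 : Nat.size (σ.var x) ≤ Z :=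
      (Nat.size_le.2 Nat.lt_two_pow_self).trans hx
    have h2 : σ.var x * (1 + C * (Z + 2) ^ D) ≤ Z * (1 + C * (Z + 2) ^ D) :=
      Nat.mul_le_mul_right _ hx
    have h3 : 1 ≤ (Z + 2) ^ D := Nat.one_le_pow _ _ (by omega)
    simp only [Prog.cost]
    calc _ ≤ 1 + Z + Z * (1 + C * (Z + 2) ^ D) := by omega
      _ ≤ (C + 2) * (Z + 2) ^ (D + 1) := by
        rw [pow_succ]
        nlinarith [Nat.zero_le (C * (Z + 2) ^ D)]

/-! ### Frame conditions and copying -/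

/-- The stores agree on the variables below `b`. -/
def Frame (b : ℕ) (σ τ : Store) : Prop := ∀ i < b, τ.var i = σ.var i

theorem Frame.refl (b : ℕ) (σ : Store) : Frame b σ σ := fun _ _ => rfl

theorem Frame.trans {b : ℕ} {σ τ υ : Store} (h : Frame b σ τ) (h' : Frame b τ υ) : Frame b σ υ :=
  fun i hi => (h' i hi).trans (h i hi)

theorem Frame.mono {b b' : ℕ} {σ τ : Store} (h : Frame b σ τ) (hb : b' ≤ b) : Frame b' σ τ :=
  fun i hi => h i (hi.trans_le hb)

@[simp] theorem frame_set {b x v : ℕ} {σ τ : Store} (h : b ≤ x) :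
    Frame b σ (τ.set x v) ↔ Frame b σ τ := by
  refine forall₂_congr fun i hi => ?_
  rw [Store.set_var, if_neg (by omega)]

@[simp] theorem frame_setStack {b s : ℕ} {l : List ℕ} {σ τ : Store} :
    Frame b σ (τ.setStack s l) ↔ Frame b σ τ := Iff.rfl

/-- Sequential composition. -/
infixr:50 " ;; " => Prog.seq

/-- `x := y` for different variables `x`, `y`. -/
def copyProg (x y : ℕ) : Prog := .const x 0 ;; .arith .add x x y

@[simp] theorem copyProg_good {Z x y : ℕ} (hxy : x ≠ y) (Q : Store → Prop) (σ : Store) :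
    (copyProg x y).Good Z Q σ ↔ σ.var y < 2 ^ Z ∧ Q ((σ.set x 0).set x (σ.var y)) := by
  simp [copyProg, hxy.symm]

theorem lt_two_pow_of_le {a Z : ℕ} (h : a ≤ Z) : a < 2 ^ Z :=
  h.trans_lt Nat.lt_two_pow_self

/-! ### Greatest common divisors -/

/-- Euclid's algorithm for the variables `40`, `41`, with the result in `40`. -/
def gcdProg : Prog :=
  .size 42 40 ;; .size 43 41 ;; .arith .add 42 42 43 ;; .const 43 1 ;; .arith .add 42 42 43 ;;
  .loop 42 (.ifPos 41 (.arith .mod 43 40 41 ;; copyProg 40 41 ;; copyProg 41 43) .skip)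

/-- The state of Euclid's algorithm after `i` passes. -/
structure GcdInv (W a b : ℕ) (σ : Store) (i : ℕ) (τ : Store) : Prop where
  gcd_eq : (τ.var 40).gcd (τ.var 41) = a.gcd b
  fst_lt : τ.var 40 < 2 ^ W
  snd_lt : τ.var 41 < 2 ^ W
  frame : Frame 40 σ τ
  stack : τ.stack = σ.stack
  decrease : τ.var 41 = 0 ∨ i = 0 ∧ τ.var 40 = a ∧ τ.var 41 = b ∨
    τ.var 41 < τ.var 40 ∧ τ.var 40 * τ.var 41 * 2 ^ i ≤ 2 * (a * b)

/-- From the second pass on, the product of the two variables at least halves. The first pass may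
only swap them, which accounts for the factor `2` in the invariant. As `a * b < 2 ^ (a.size +
b.size)`, one pass more than `a.size + b.size` forces the second variable to `0`, after which passes
are idle. -/
theorem gcdProg_good {Z W : ℕ} {Q : Store → Prop} {σ : Store} (ha : σ.var 40 < 2 ^ W)
    (hb : σ.var 41 < 2 ^ W) (hW : 2 * W + 1 ≤ Z)
    (hQ : ∀ τ : Store, τ.var 40 = (σ.var 40).gcd (σ.var 41) → Frame 40 σ τ →
      τ.stack = σ.stack → Q τ) : gcdProg.Good Z Q σ := by
  have hWZ : 2 ^ W ≤ 2 ^ Z := Nat.pow_le_pow_right (by norm_num) (by omega)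
  have hsa := Nat.size_le.2 ha
  have hsb := Nat.size_le.2 hb
  have hZ : Z < 2 ^ Z := Nat.lt_two_pow_self
  simp [gcdProg]
  refine ⟨by omega, by omega, by omega, by omega, by omega, by omega, ?_⟩
  set a := σ.var 40 with ha'
  set b := σ.var 41 with hb'
  refine good_loop (GcdInv W a b σ) ?_ ?_ ?_ ?_
  · simp; omega
  · constructor <;> simp [← ha', ← hb', ha, hb, Frame.refl]
  · rintro i - τ ⟨h1, h2, h3, h4, h5, h6⟩
    simp
    refine ⟨by omega, fun hpos => ?_, fun h0 => ?_⟩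
    · have hm := Nat.mod_lt (τ.var 40) hpos
      refine ⟨by omega, by omega, by omega, ?_⟩
      constructor <;> simp [h3, h4, h5]
      · rw [← h1, Nat.gcd_comm (τ.var 40), Nat.gcd_rec (τ.var 41) (τ.var 40), Nat.gcd_comm]
      · omega
      · right
        refine ⟨hm, ?_⟩
        rcases h6 with h6 | ⟨rfl, h6, h7⟩ | ⟨h6, h7⟩
        · omega
        · rw [← h6, ← h7]
          have := Nat.mul_le_mul_left (τ.var 41) (Nat.mod_le (τ.var 40) (τ.var 41))
          rw [zero_add, pow_one, mul_comm (τ.var 40)]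
          linarith
        -- The quotient is at least `1`, so the dividend is at least divisor plus remainder, and the
        -- remainder is the smaller of these.
        · have h8 : 2 * (τ.var 40 % τ.var 41) ≤ τ.var 40 := by
            have := Nat.div_add_mod (τ.var 40) (τ.var 41)
            have := Nat.div_pos h6.le hpos
            nlinarith
          calc _ = τ.var 41 * 2 ^ i * (2 * (τ.var 40 % τ.var 41)) := by ring
            _ ≤ τ.var 41 * 2 ^ i * τ.var 40 := Nat.mul_le_mul_left _ h8
            _ ≤ _ := by linarith
    · exact ⟨h1, h2, h3, h4, h5, Or.inl h0⟩
  · rintro τ ⟨h1, h2, h3, h4, h5, h6⟩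
    have h0 : τ.var 41 = 0 := by
      by_contra hne
      rcases h6 with h6 | ⟨h6, -⟩ | ⟨h6, h7⟩
      · exact hne h6
      · simp at h6
      · simp at h7
        have h8 : a * b < 2 ^ (a.size + b.size) := by
          rw [pow_add]
          exact Nat.mul_lt_mul'' (Nat.lt_size_self a) (Nat.lt_size_self b)
        have h9 : 1 ≤ τ.var 40 * τ.var 41 :=
          Nat.mul_pos (by omega) (by omega)
        rw [pow_succ] at h7
        have h10 := Nat.mul_le_mul_right (2 ^ (a.size + b.size) * 2) h9
        omega
    rw [h0, Nat.gcd_zero_right] at h1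
    exact hQ τ h1 h4 h5

/-! ### Perfect powers -/

@[simp] theorem Store.set_set (σ : Store) (x v w : ℕ) : (σ.set x v).set x w = σ.set x w := by
  simp [Store.set]

/-- Variable `36` becomes the power of variable `35` whose exponent is variable `30`. -/
def powProg : Prog := .const 36 1 ;; .loop 30 (.arith .mul 36 36 35)

theorem powProg_good {Z W : ℕ} {Q : Store → Prop} {σ : Store} (hb : σ.var 35 < 2 ^ W)
    (hW : 1 ≤ W) (hZ : W * σ.var 30 ≤ Z) (hWZ : W ≤ Z) (hQ : Q (σ.set 36 (σ.var 35 ^ σ.var 30))) :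
    powProg.Good Z Q σ := by
  simp [powProg]
  refine good_loop (fun i τ => τ = σ.set 36 (σ.var 35 ^ i)) ?_ ?_ ?_ ?_
  · simp; nlinarith
  · simp
  · rintro i hi τ rfl
    simp at hi ⊢
    refine ⟨?_, hb.trans_le (Nat.pow_le_pow_right (by norm_num) hWZ), ?_⟩
    · rcases Nat.eq_zero_or_pos i with rfl | hi0
      · simp; omega
      · calc _ < (2 ^ W) ^ i := Nat.pow_lt_pow_left hb (by omega)
          _ = 2 ^ (W * i) := by rw [pow_mul]
          _ ≤ 2 ^ Z := Nat.pow_le_pow_right (by norm_num)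
            ((Nat.mul_le_mul_left W hi.le).trans hZ)
    · rw [pow_succ]
  · rintro τ rfl
    exact hQ

/-- For the variables `a`, `e` with the numbers `20`, `30`, and the bit length of `a` in `31`,
the integral part `q` of the `e`-th root of `a` is put into `33` and `q ^ e` into `34`. -/
def floorRootProg : Prog :=
  .const 32 1 ;; .const 37 2 ;; .loop 31 (.arith .mul 32 32 37) ;; .const 33 0 ;; .const 34 0 ;;
  .loop 31
    (.const 37 2 ;; .arith .div 32 32 37 ;; .arith .add 35 33 32 ;; powProg ;;
      .arith .sub 37 36 20 ;; .ifPos 37 .skip (copyProg 33 35 ;; copyProg 34 36))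

/-- The state of the root extraction after `i` passes. -/
structure FloorRootInv (a e s : ℕ) (σ : Store) (i : ℕ) (τ : Store) : Prop where
  bit : τ.var 32 = 2 ^ (s - i)
  pow_eq : τ.var 34 = τ.var 33 ^ e
  pow_le : τ.var 33 ^ e ≤ a
  lt_pow : a < (τ.var 33 + 2 ^ (s - i)) ^ e
  frame : Frame 32 σ τ
  stack : τ.stack = σ.stack

/-- The binary digits of the root are found from the top. The root lies in an interval of length `2
^ (s - i)` that starts at variable `33`, and each pass halves the interval. Initially `a < 2 ^ s`
for the bit length `s`, and at the end the interval has length one. -/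
theorem floorRootProg_good {Z m : ℕ} {Q : Store → Prop} {σ : Store}
    (hs : σ.var 31 = (σ.var 20).size) (he : 1 ≤ σ.var 30) (hem : σ.var 30 ≤ m + 1)
    (hm : (σ.var 20).size ≤ m) (hZ : (m + 2) * (m + 2) ≤ Z)
    (hQ : ∀ τ : Store, τ.var 34 = τ.var 33 ^ σ.var 30 → τ.var 33 ^ σ.var 30 ≤ σ.var 20 →
      σ.var 20 < (τ.var 33 + 1) ^ σ.var 30 → Frame 32 σ τ → τ.stack = σ.stack → Q τ) :
    floorRootProg.Good Z Q σ := by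
  set a := σ.var 20 with ha
  set e := σ.var 30 with he'
  have hmZ : m + 2 < Z := by nlinarith
  have hlt : ∀ {x : ℕ}, x ≤ m + 1 → 2 ^ x < 2 ^ Z :=
    fun h => Nat.pow_lt_pow_right (by norm_num) (by omega)
  have hlt2 : ∀ {x y : ℕ}, x < 2 ^ y → y ≤ Z → x < 2 ^ Z :=
    fun h h' => h.trans_le (Nat.pow_le_pow_right (by norm_num) h')
  have ham : a < 2 ^ m := Nat.size_le.1 hm
  have h2 : 2 < 2 ^ Z := lt_two_pow_of_le (by omega)
  simp [floorRootProg]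
  refine good_loop (fun i τ => τ = ((σ.set 32 1).set 37 2).set 32 (2 ^ i)) ?_ ?_ ?_ ?_
  · simp [hs]; omega
  · simp [Store.set]
  · rintro i hi τ rfl
    simp [hs] at hi ⊢
    refine ⟨hlt (by omega), h2, ?_⟩
    rw [pow_succ]
  rintro τ rfl
  simp [hs]
  refine good_loop (FloorRootInv a e a.size σ) ?_ ?_ ?_ ?_
  · simp [hs]; omega
  · constructor <;> simp [Frame.refl]
    · rw [zero_pow (by omega)]
    · rw [zero_pow (by omega)]
      exact Nat.zero_le _
    · exact (Nat.lt_size_self a).trans_le (Nat.le_self_pow (by omega) _)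
  · rintro i hi τ ⟨h1, h2', h3, h4, h5, h6⟩
    simp [hs] at hi
    have h20 : τ.var 20 = a := h5 20 (by norm_num)
    have h30 : τ.var 30 = e := h5 30 (by norm_num)
    have hpow : (2 : ℕ) ^ (a.size - i) = 2 * 2 ^ (a.size - (i + 1)) := by
      rw [← pow_succ']
      congr 1
      omega
    have hq : τ.var 33 < 2 ^ m :=
      (Nat.le_self_pow (by omega) _).trans_lt (h3.trans_lt ham)
    have hb : (2 : ℕ) ^ (a.size - (i + 1)) ≤ 2 ^ m :=
      Nat.pow_le_pow_right (by norm_num) (by omega)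
    have hdiv : τ.var 32 / 2 = 2 ^ (a.size - (i + 1)) := by rw [h1, hpow]; simp
    simp [hdiv]
    have hc : τ.var 33 + 2 ^ (a.size - (i + 1)) < 2 ^ (m + 1) := by rw [pow_succ]; omega
    refine ⟨h1 ▸ hlt (by omega), h2, hlt2 hq (by omega), hlt (by omega), ?_⟩
    refine powProg_good (W := m + 1) (by simpa using hc) (by omega)
      (by simp [h30]; nlinarith) (by omega) ?_
    -- The trial base is below `2 ^ (m + 1)` and the exponent is at most `m + 1`. This power is the
    -- reason for a bound `Z` quadratic in `m`.
    have hpw : (τ.var 33 + 2 ^ (a.size - (i + 1))) ^ e < 2 ^ Z := by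
      calc _ < (2 ^ (m + 1)) ^ e := Nat.pow_lt_pow_left hc (by omega)
        _ = 2 ^ ((m + 1) * e) := by rw [pow_mul]
        _ ≤ 2 ^ Z := Nat.pow_le_pow_right (by norm_num) (by nlinarith)
    simp [h30, h20]
    refine ⟨hpw, hlt2 ham (by omega), by omega, fun h => ?_, fun h => ?_⟩
    · constructor <;> simp [h2', h5, h6, h3]
      exact h
    · refine ⟨hlt2 hc (by omega), hpw, ?_⟩
      constructor <;> simp [h5, h6]
      · exact Nat.sub_eq_zero_iff_le.1 h
      · rw [add_assoc, ← two_mul, ← hpow]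
        exact h4
  · simp [hs]
    rintro τ ⟨h1, h2', h3, h4, h5, h6⟩
    exact hQ τ h2' h3 (by simpa using h4) h5 h6

/-- The case that variable `20` is a perfect power `q ^ e` is recorded in the variables `21` to
`25`. -/
def rootProg : Prog :=
  .size 31 20 ;; .const 30 1 ;;
  .loop 31
    (.const 37 1 ;; .arith .add 30 30 37 ;; floorRootProg ;; .arith .sub 37 20 34 ;;
      .ifPos 37 .skip
        (copyProg 21 20 ;; copyProg 22 20 ;; copyProg 23 33 ;; .const 24 1 ;; .const 25 1))

/-- The variables `21` to `25` say that `a` is a power of variable `23`. -/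
structure RootData (a : ℕ) (τ : Store) : Prop where
  fst : τ.var 21 = a
  snd : τ.var 22 = a
  root : ∃ e, 2 ≤ e ∧ τ.var 23 ^ e = a
  one : τ.var 24 = 1
  one' : τ.var 25 = 1

/-- The state of the search for a root after `i` passes. -/
structure RootInv (a : ℕ) (σ : Store) (i : ℕ) (τ : Store) : Prop where
  exp : τ.var 30 = i + 1
  size : τ.var 31 = a.size
  frame : Frame 21 σ τ
  stack : τ.stack = σ.stack
  data : (Frame 26 σ τ ∧ ∀ q e, 2 ≤ e → e ≤ i + 1 → a ≠ q ^ e) ∨ RootData a τ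

/-- The exponents `2, …, a.size + 1` are tried. The number `a` is an `e`-th power exactly if the
power of its rounded root is `a` itself. -/
theorem rootProg_good {Z m : ℕ} {Q : Store → Prop} {σ : Store} (ha2 : 2 ≤ σ.var 20)
    (hm : (σ.var 20).size ≤ m) (hZ : (m + 2) * (m + 2) ≤ Z)
    (hQ : ∀ τ : Store, Frame 21 σ τ → τ.stack = σ.stack →
      ((Frame 26 σ τ ∧ ∀ q e, 2 ≤ e → σ.var 20 ≠ q ^ e) ∨ RootData (σ.var 20) τ) → Q τ) :
    rootProg.Good Z Q σ := by
  set a := σ.var 20 with ha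
  have hmZ : m + 2 < Z := by nlinarith
  have hlt2 : ∀ {x y : ℕ}, x < 2 ^ y → y ≤ Z → x < 2 ^ Z :=
    fun h h' => h.trans_le (Nat.pow_le_pow_right (by norm_num) h')
  have ham : a < 2 ^ m := Nat.size_le.1 hm
  simp [rootProg]
  refine ⟨hlt2 ham (by omega), ?_⟩
  refine good_loop (RootInv a σ) ?_ ?_ ?_ ?_
  · simp [← ha]; omega
  · constructor <;> simp [Frame.refl, ← ha]
    left
    intro q e h1 h2
    omega
  · rintro i hi τ ⟨h1, h2, h3, h4, h5⟩
    simp [← ha] at hi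
    have h20 : τ.var 20 = a := h3 20 (by norm_num)
    simp [h1]
    refine ⟨lt_two_pow_of_le (by omega), by omega, ?_⟩
    refine floorRootProg_good (m := m) (by simp [h2, h20]) (by simp) (by simp; omega)
      (by simpa [h20] using hm) hZ ?_
    simp [h20]
    intro υ k1 k2 k3 k4 k5
    have hfr : Frame 30 τ υ := fun j hj => by
      have := k4 j (by omega)
      rw [this]
      simp
      rw [if_neg (by omega), if_neg (by omega)]
    have hv20 : υ.var 20 = a := (hfr 20 (by norm_num)).trans h20
    have hv30 : υ.var 30 = i + 1 + 1 := by simpa using k4 30 (by norm_num)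
    have hv31 : υ.var 31 = a.size := by simpa [h2] using k4 31 (by norm_num)
    have hv33 : υ.var 33 ≤ υ.var 33 ^ (i + 1 + 1) := Nat.le_self_pow (by omega) _
    refine ⟨hlt2 (hv20 ▸ ham) (by omega), hlt2 (k1 ▸ k2.trans_lt ham) (by omega), ?_, ?_, ?_⟩
    · rw [hv20]
      exact hlt2 ((Nat.sub_le _ _).trans_lt ham) (by omega)
    · rw [hv20, k1]
      intro hpos
      constructor <;> simp [hv30, hv31, k5, h4]
      · exact h3.trans (hfr.mono (by norm_num))
      · rcases h5 with ⟨h5, h6⟩ | h5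
        · left
          refine ⟨h5.trans (hfr.mono (by norm_num)), fun q e he hei hq => ?_⟩
          rcases Nat.lt_or_ge e (i + 1 + 1) with hlt | hge
          · exact h6 q e he (by omega) hq
          · obtain rfl : e = i + 1 + 1 := by omega
            rw [hq] at k2 k3 hpos
            have h7 := lt_of_pow_lt_pow_left' _ k3
            have h8 := Nat.pow_le_pow_left (Nat.lt_succ_iff.1 h7) (i + 1 + 1)
            omega
        · right
          obtain ⟨d1, d2, d3, d4, d5⟩ := h5
          constructor <;> simp [hfr 21, hfr 22, hfr 23, hfr 24, hfr 25, *]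
          exact d3
    · rw [hv20, k1]
      intro h0
      refine ⟨hlt2 ham (by omega), hlt2 (hv33.trans_lt (k2.trans_lt ham)) (by omega), ?_⟩
      constructor <;> simp [hv30, hv31, k5, h4]
      · exact h3.trans (hfr.mono (by norm_num))
      · right
        constructor <;> simp
        exact ⟨i + 1 + 1, by omega, by omega⟩
  · simp [← ha]
    rintro τ ⟨h1, h2, h3, h4, h5⟩
    refine hQ τ h3 h4 (h5.imp (fun h => ⟨h.1, fun q e he hq => ?_⟩) id)
    -- No exponent beyond the tested range occurs: the base is at least `2`, hence `2 ^ e ≤ a < 2 ^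
    -- a.size`.
    refine h.2 q e he ?_ hq
    have hq2 : 2 ≤ q := by
      by_contra hlt
      interval_cases q
      · rw [zero_pow (by omega)] at hq; omega
      · simp at hq; omega
    by_contra hgt
    have h6 : 2 ^ e ≤ a := hq ▸ Nat.pow_le_pow_left hq2 e
    have h7 := Nat.lt_size.2 h6
    omega

/-! ### One step of the reduction of a list -/

/-- `n` numbers are moved from the stack `s` to the stack `s'` by way of the variable `v`. -/
def moveProg (n v s s' : ℕ) : Prog := .loop n (.pop v s ;; .push s' v)

theorem moveProg_good {Z n v s s' : ℕ} {l : List ℕ} {Q : Store → Prop} {σ : Store} (hs : s ≠ s')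
    (hl : σ.stack s = l) (hn : σ.var n = l.length) (hZ : l.length ≤ Z)
    (hlt : ∀ x ∈ l, x < 2 ^ Z)
    (hQ : ∀ τ : Store, τ.stack s = [] → τ.stack s' = l.reverse ++ σ.stack s' →
      (∀ t, t ≠ s → t ≠ s' → τ.stack t = σ.stack t) → (∀ i, i ≠ v → τ.var i = σ.var i) → Q τ) :
    (moveProg n v s s').Good Z Q σ := by
  refine good_loop_list l (fun pre suf τ => τ.stack s = suf ∧
    τ.stack s' = pre.reverse ++ σ.stack s' ∧ (∀ t, t ≠ s → t ≠ s' → τ.stack t = σ.stack t) ∧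
    ∀ i, i ≠ v → τ.var i = σ.var i) hn hZ ?_ ?_ ?_
  · simp [hl]
  · rintro pre a suf rfl τ ⟨h1, h2, h3, h4⟩
    have ha : a < 2 ^ Z := hlt a (by simp)
    simp [h1, h2, hs, hs.symm, ha]
    refine ⟨fun t ht ht' => ?_, fun i hi => ?_⟩
    · rw [if_neg ht', if_neg ht, h3 t ht ht']
    · rw [if_neg hi, h4 i hi]
  · rintro τ ⟨h1, h2, h3, h4⟩
    exact hQ τ h1 h2 h3 h4

/-- The contents of the variables `21` to `25`. -/
def Store.data (σ : Store) : ℕ × ℕ × ℕ × ℕ × ℕ :=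
  (σ.var 21, σ.var 22, σ.var 23, σ.var 24, σ.var 25)

theorem Frame.data_eq {σ τ : Store} (h : Frame 26 σ τ) : τ.data = σ.data := by
  simp [Store.data, h 21, h 22, h 23, h 24, h 25]

/-- Two elements of the list with a common factor, their greatest common divisor and their
cofactors. -/
def IsPairData (l : List ℕ) (d : ℕ × ℕ × ℕ × ℕ × ℕ) : Prop :=
  ∃ a b rest, l.Perm (a :: b :: rest) ∧ a.gcd b ≠ 1 ∧
    d = (a, b, a.gcd b, a / a.gcd b, b / a.gcd b)

/-- An element of the list that is a perfect power, and a root of it. -/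
def IsRootData (l : List ℕ) (d : ℕ × ℕ × ℕ × ℕ × ℕ) : Prop :=
  ∃ q e, 2 ≤ e ∧ q ^ e ∈ l ∧ d = (q ^ e, q ^ e, q, 1, 1)

/-- The perfect powers among the numbers on stack `1` are looked for, while these are moved to
stack `2`. -/
def rootPassProg : Prog := .loop 10 (.pop 20 1 ;; .push 2 20 ;; rootProg)

/-- The state of the search for perfect powers. -/
structure RootPassInv (l : List ℕ) (σ : Store) (pre suf : List ℕ) (τ : Store) : Prop where
  stack_one : τ.stack 1 = suf
  stack_two : τ.stack 2 = pre.reverse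
  stack : ∀ s, s ≠ 1 → s ≠ 2 → τ.stack s = σ.stack s
  frame : Frame 20 σ τ
  data : (τ.data = σ.data ∧ ∀ x ∈ pre, ∀ q e, 2 ≤ e → x ≠ q ^ e) ∨ IsRootData l τ.data

/-- A later find overwrites an earlier one. It suffices to know that some root was recorded, or that
nothing was written and no number seen so far is a perfect power. -/
theorem rootPassProg_good {Z m : ℕ} {l : List ℕ} {Q : Store → Prop} {σ : Store}
    (hl : σ.stack 1 = l) (hn : σ.var 10 = l.length) (hnZ : l.length ≤ Z)
    (h2 : σ.stack 2 = []) (hl2 : ∀ x ∈ l, 2 ≤ x) (hlm : ∀ x ∈ l, x < 2 ^ m)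
    (hZ : (m + 2) * (m + 2) ≤ Z)
    (hQ : ∀ τ : Store, RootPassInv l σ l [] τ → Q τ) : rootPassProg.Good Z Q σ := by
  have hmZ : m + 2 < Z := by nlinarith
  have hWZ : 2 ^ m ≤ 2 ^ Z := Nat.pow_le_pow_right (by norm_num) (by omega)
  refine good_loop_list l (RootPassInv l σ) hn hnZ ?_ ?_ hQ
  · constructor <;> simp [hl, h2, Frame.refl]
  · rintro pre a suf hpre τ ⟨h1, h2, h3, h4, h5⟩
    have ha : a ∈ l := by simp [hpre]
    have haZ := (hlm a ha).trans_le hWZ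
    simp [h1, h2, haZ]
    refine rootProg_good (m := m) (by simpa using hl2 a ha)
      (by simpa using Nat.size_le.2 (hlm a ha)) hZ ?_
    simp
    intro υ k1 k2 k3
    have hfr : Frame 20 τ υ := fun j hj => by
      have := k1 j (by omega)
      rw [this]
      simp
      omega
    constructor <;> try simp [k2]
    · intro s hs hs'
      rw [if_neg hs', if_neg hs, h3 s hs hs']
    · exact h4.trans hfr
    · rcases k3 with ⟨k3, k4⟩ | k3
      · have hd : υ.data = τ.data := by
          rw [k3.data_eq]
          simp [Store.data]
        rw [hd]
        refine h5.imp (fun h => ⟨h.1, ?_⟩) id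
        rintro x (hx | rfl) q e he
        · exact h.2 x hx q e he
        · exact k4 q e he
      · right
        obtain ⟨d1, d2, ⟨e, he, d3⟩, d4, d5⟩ := k3
        refine ⟨υ.var 23, e, he, d3 ▸ ha, ?_⟩
        simp [Store.data, d1, d2, d3, d4, d5]

/-- The number in variable `20` is compared with the numbers on stack `2`, which are moved to
stack `3`. -/
def compareProg : Prog :=
  .loop 12
    (.pop 13 2 ;; .push 3 13 ;; copyProg 40 20 ;; copyProg 41 13 ;; gcdProg ;;
      .const 16 1 ;; .arith .sub 15 40 16 ;;
      .ifPos 15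
        (copyProg 21 20 ;; copyProg 22 13 ;; copyProg 23 40 ;; .arith .div 24 20 40 ;;
          .arith .div 25 13 40)
        .skip)

/-- The state of the comparison of a number with the later ones. -/
structure CompareInv (l : List ℕ) (a : ℕ) (σ : Store) (pre suf : List ℕ) (τ : Store) :
    Prop where
  stack_two : τ.stack 2 = suf
  stack_three : τ.stack 3 = pre.reverse
  stack : ∀ s, s ≠ 2 → s ≠ 3 → τ.stack s = σ.stack s
  frame : Frame 13 σ τ
  var_eq : τ.var 20 = a
  data : (τ.data = σ.data ∧ ∀ x ∈ pre, a.Coprime x) ∨ IsPairData l τ.data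

theorem compareProg_good {Z m : ℕ} {l pre suf : List ℕ} {a : ℕ} {Q : Store → Prop} {σ : Store}
    (hpre : l = pre ++ a :: suf) (h2 : σ.stack 2 = suf) (h3 : σ.stack 3 = [])
    (ha : σ.var 20 = a) (hn : σ.var 12 = suf.length)
    (hnZ : l.length ≤ Z) (hl2 : ∀ x ∈ l, 2 ≤ x) (hlm : ∀ x ∈ l, x < 2 ^ m)
    (hZ : (m + 2) * (m + 2) ≤ Z)
    (hQ : ∀ τ : Store, CompareInv l a σ suf [] τ → Q τ) : compareProg.Good Z Q σ := by
  have hmZ : m + 2 < Z := by nlinarith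
  have hWZ : 2 ^ m ≤ 2 ^ Z := Nat.pow_le_pow_right (by norm_num) (by omega)
  have hlen : l.length = pre.length + (suf.length + 1) := by simp [hpre]
  have haZ : a < 2 ^ m := hlm a (by simp [hpre])
  have ha2 : 2 ≤ a := hl2 a (by simp [hpre])
  refine good_loop_list suf (CompareInv l a σ) hn (by omega) ?_ ?_ hQ
  · constructor <;> simp [h2, h3, ha, Frame.refl]
  · rintro pre' b suf' hsuf τ ⟨h1, h2, h3, h4, h5, h6⟩
    have hbZ : b < 2 ^ m := hlm b (by simp [hpre, hsuf])
    simp [h1, h2, h5, haZ.trans_le hWZ, hbZ.trans_le hWZ]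
    refine gcdProg_good (W := m) (by simpa using haZ) (by simpa using hbZ) (by nlinarith) ?_
    simp
    intro υ k1 k2 k3
    have hfr : Frame 13 τ υ := fun j hj => by
      have := k2 j (by omega)
      rw [this]
      simp
      split_ifs <;> first | rfl | omega
    have k20 : υ.var 20 = a := by simpa [h5] using k2 20 (by norm_num)
    have k13 : υ.var 13 = b := by simpa using k2 13 (by norm_num)
    have hg : a.gcd b ≤ a := Nat.gcd_le_left b (by omega)
    have hg0 : 0 < a.gcd b := Nat.gcd_pos_of_pos_left b (by omega)
    have hkd : υ.data = τ.data := by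
      simp [Store.data, k2 21, k2 22, k2 23, k2 24, k2 25]
    simp [k1, k20, k13]
    refine ⟨by omega, by omega, by omega, fun hpos => ?_, fun h0 => ?_⟩
    · refine ⟨by omega, by omega, by omega, by omega, by omega, by omega, by omega, ?_⟩
      constructor <;> try simp [k3]
      · intro s hs hs'
        rw [if_neg hs', if_neg hs, h3 s hs hs']
      · exact h4.trans hfr
      · exact k20
      · right
        -- The pair consists of two positions of the list, so `a = b` is allowed. Equal entries of
        -- the list are thus found as well.
        refine ⟨a, b, pre ++ pre' ++ suf', ?_, by omega, by simp [Store.data]⟩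
        rw [hpre, hsuf, ← Multiset.coe_eq_coe]
        simp only [← Multiset.coe_add, ← Multiset.cons_coe]
        simp only [← Multiset.singleton_add]
        abel
    · constructor <;> try simp [k3]
      · intro s hs hs'
        rw [if_neg hs', if_neg hs, h3 s hs hs']
      · exact h4.trans hfr
      · exact k20
      · have hd : ((υ.set 16 1).set 15 0).data = τ.data := by
          simp [Store.data] at hkd ⊢
          exact hkd
        have h0' : a.gcd b - 1 = 0 := by omega
        rw [h0', hd]
        refine h6.imp (fun h => ⟨h.1, ?_⟩) id
        rintro x (hx | rfl)
        · exact h.2 x hx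
        · show a.gcd x = 1
          omega

/-- Pairs of numbers on stack `2` that have a common factor are looked for, while the numbers are
moved to stack `1`. -/
def pairPassProg : Prog :=
  copyProg 12 10 ;;
  .loop 10
    (.pop 20 2 ;; .push 1 20 ;; .const 16 1 ;; .arith .sub 12 12 16 ;; compareProg ;;
      moveProg 12 13 3 2)

/-- The state of the search for pairs. -/
structure PairPassInv (l : List ℕ) (σ : Store) (pre suf : List ℕ) (τ : Store) : Prop where
  stack_one : τ.stack 1 = pre.reverse
  stack_two : τ.stack 2 = suf
  stack : ∀ s, s ≠ 1 → s ≠ 2 → τ.stack s = σ.stack s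
  frame : Frame 12 σ τ
  rest : τ.var 12 = suf.length
  data : (τ.data = σ.data ∧ (suf.Pairwise Nat.Coprime → l.Pairwise Nat.Coprime)) ∨
    IsPairData l τ.data

/-- Each number is compared with the later ones only. The invariant says that coprimality of what
remains would imply coprimality of the whole list, so at the end, when nothing remains, the list
itself is pairwise coprime unless a pair was recorded. -/
theorem pairPassProg_good {Z m : ℕ} {l : List ℕ} {Q : Store → Prop} {σ : Store}
    (hl : σ.stack 2 = l) (hn : σ.var 10 = l.length) (hnZ : l.length ≤ Z)
    (h1 : σ.stack 1 = []) (h3 : σ.stack 3 = []) (hl2 : ∀ x ∈ l, 2 ≤ x)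
    (hlm : ∀ x ∈ l, x < 2 ^ m) (hZ : (m + 2) * (m + 2) ≤ Z)
    (hQ : ∀ τ : Store, PairPassInv l σ l [] τ → Q τ) : pairPassProg.Good Z Q σ := by
  have hmZ : m + 2 < Z := by nlinarith
  have hWZ : 2 ^ m ≤ 2 ^ Z := Nat.pow_le_pow_right (by norm_num) (by omega)
  have hZZ : Z < 2 ^ Z := Nat.lt_two_pow_self
  simp [pairPassProg, hn]
  refine ⟨by omega, ?_⟩
  refine good_loop_list l (PairPassInv l σ) (by simpa using hn) hnZ ?_ ?_ hQ
  · constructor <;> simp [hl, h1, Store.data, Frame.refl]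
  · rintro pre a suf hpre τ ⟨h1, h2, h4, h5, h6, h7⟩
    have hlen : l.length = pre.length + (suf.length + 1) := by simp [hpre]
    have ha : a ∈ l := by simp [hpre]
    have haZ := (hlm a ha).trans_le hWZ
    simp [h1, h2, h6, haZ]
    refine ⟨by omega, by omega, ?_⟩
    refine compareProg_good (suf := suf) (a := a) hpre (by simp) (by simp [h4, h3]) (by simp)
      (by simp) hnZ hl2 hlm hZ ?_
    rintro υ ⟨k1, k2, k3, k4, k5, k6⟩
    have hv12 : υ.var 12 = suf.length := by simpa using k4 12 (by norm_num)
    refine moveProg_good (l := suf.reverse) (by norm_num) k2 (by simpa using hv12)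
      (by simp; omega) (fun x hx => (hlm x ?_).trans_le hWZ) ?_
    · rw [List.mem_reverse] at hx
      simp [hpre, hx]
    · intro ρ j1 j2 j3 j4
      have hd : ρ.data = υ.data := by simp [Store.data, j4]
      refine ⟨?_, ?_, ?_, ?_, ?_, ?_⟩
      · rw [j3 1 (by norm_num) (by norm_num), k3 1 (by norm_num) (by norm_num)]
        simp
      · rw [j2, k1]
        simp
      · intro s hs hs'
        by_cases hs3 : s = 3
        · rw [hs3, j1, h3]
        · rw [j3 s hs3 hs', k3 s hs' hs3]
          simp [hs, hs', h4]
      · intro i hi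
        rw [j4 i (by omega), k4 i (by omega)]
        simp
        rw [if_neg (by omega), if_neg (by omega), if_neg (by omega), h5 i hi]
      · rw [j4 12 (by norm_num), hv12]
      · rw [hd]
        rcases k6 with ⟨k6, k7⟩ | k6
        · rw [k6]
          simp [Store.data] at h7 ⊢
          refine h7.imp (fun h => ⟨h.1, fun hs => h.2 k7 hs⟩) id
        · exact Or.inr k6

/-- `20 ≠ 21` and `20 ≠ 22` are tested, the result is positive if both hold. -/
def differProg : Prog :=
  .arith .sub 14 20 21 ;; .arith .sub 15 21 20 ;; .arith .add 14 14 15 ;;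
  .arith .sub 15 20 22 ;; .arith .sub 16 22 20 ;; .arith .add 15 15 16 ;; .arith .mul 14 14 15

/-- The numbers on stack `1` that differ from the variables `21` and `22` are moved to stack `2`,
and are counted in variable `17`. -/
def filterProg : Prog :=
  .const 17 0 ;;
  .loop 10
    (.pop 20 1 ;; differProg ;;
      .ifPos 14 (.push 2 20 ;; .const 16 1 ;; .arith .add 17 17 16) .skip)

/-- The state of the removal of two numbers `a`, `b`. -/
structure FilterInv (a b : ℕ) (σ : Store) (pre suf : List ℕ) (τ : Store) : Prop where
  stack_one : τ.stack 1 = suf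
  stack_two : τ.stack 2 = (pre.filter fun x => x ≠ a ∧ x ≠ b).reverse
  stack : ∀ s, s ≠ 1 → s ≠ 2 → τ.stack s = σ.stack s
  frame : Frame 14 σ τ
  data : τ.data = σ.data
  count : τ.var 17 = (pre.filter fun x => x ≠ a ∧ x ≠ b).length

/-- With truncated subtraction `x - a + (a - x)` is the distance of `x` and `a`, so the product
tested is positive exactly if `x` differs from both `a` and `b`. All copies of `a` and `b`
disappear. -/
theorem filterProg_good {Z m : ℕ} {l : List ℕ} {Q : Store → Prop} {σ : Store}
    (hl : σ.stack 1 = l) (hn : σ.var 10 = l.length) (hnZ : l.length < Z)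
    (h2 : σ.stack 2 = []) (hlm : ∀ x ∈ l, x < 2 ^ m) (ha : σ.var 21 < 2 ^ m)
    (hb : σ.var 22 < 2 ^ m) (hZ : 2 * m + 2 < Z)
    (hQ : ∀ τ : Store, FilterInv (σ.var 21) (σ.var 22) σ l [] τ → Q τ) :
    filterProg.Good Z Q σ := by
  have hWZ : 2 * 2 ^ m ≤ 2 ^ Z := by
    rw [← pow_succ']
    exact Nat.pow_le_pow_right (by norm_num) (by omega)
  have hZZ : Z < 2 ^ Z := Nat.lt_two_pow_self
  have hWZ2 : ∀ {x y : ℕ}, x < 2 ^ m → y < 2 ^ m → x - y + (y - x) < 2 ^ Z := by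
    intro x y hx hy
    omega
  set a := σ.var 21 with ha'
  set b := σ.var 22 with hb'
  simp [filterProg]
  refine good_loop_list l (FilterInv a b σ) (by simpa using hn) hnZ.le ?_ ?_ hQ
  · constructor <;> simp [hl, h2, Store.data, Frame.refl]
  · rintro pre x suf hpre τ ⟨h1, h3, h4, h5, h6, h7⟩
    have hx := hlm x (by simp [hpre])
    have h8 : τ.var 21 = a := by simp [Store.data] at h6; exact h6.1
    have h9 : τ.var 22 = b := by simp [Store.data] at h6; exact h6.2.1
    have hlen : l.length = pre.length + (suf.length + 1) := by simp [hpre]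
    have hcount := List.length_filter_le (fun x => decide (x ≠ a ∧ x ≠ b)) pre
    simp only [differProg]
    simp [h1, h3, h8, h9]
    have e1 := hWZ2 hx ha
    have e2 := hWZ2 hx hb
    have e3 : (x - a + (a - x)) * (x - b + (b - x)) < 2 ^ Z := by
      calc _ < 2 ^ m * 2 ^ m := Nat.mul_lt_mul'' (by omega) (by omega)
        _ = 2 ^ (2 * m) := by rw [← pow_add, two_mul]
        _ ≤ 2 ^ Z := Nat.pow_le_pow_right (by norm_num) (by omega)
    refine ⟨by omega, by omega, by omega, by omega, by omega, by omega, by omega, by omega,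
      by omega, by omega, e1, e2, e3, fun hxa hxb => ⟨by omega, by omega, by omega, ?_⟩,
      fun heq => ?_⟩
    · have hf : (pre ++ [x]).filter (fun x => decide (x ≠ a ∧ x ≠ b)) =
          pre.filter (fun x => decide (x ≠ a ∧ x ≠ b)) ++ [x] := by
        simp [List.filter_append, Ne.symm hxa, Ne.symm hxb]
      refine ⟨by simp, by rw [hf]; simp, fun s hs hs' => ?_, by simpa using h5, ?_, ?_⟩
      · simp [hs, hs', h4]
      · rw [← h6]
        simp [Store.data]
      · simp only [hf, List.length_append]
        simp [h7]
    · have hf : (pre ++ [x]).filter (fun x => decide (x ≠ a ∧ x ≠ b)) =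
          pre.filter (fun x => decide (x ≠ a ∧ x ≠ b)) := by
        have : ¬ (x ≠ a ∧ x ≠ b) := by omega
        simp only [List.filter_append, List.filter_singleton, this, decide_false]
        simp
      refine ⟨by simp, by rw [hf]; simpa using h3, fun s hs hs' => ?_, by simpa using h5, ?_, ?_⟩
      · simp [hs, h4 s hs hs']
      · rw [← h6]
        simp [Store.data]
      · rw [hf, ← h7]
        simp

/-- A variable that exceeds `1` is pushed to stack `2` and counted in variable `17`. -/
def pushIfProg (x : ℕ) : Prog :=
  .const 16 1 ;; .arith .sub 15 x 16 ;; .ifPos 15 (.push 2 x ;; .arith .add 17 17 16) .skip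

theorem pushIfProg_good {Z x v c : ℕ} {r : List ℕ} {Q : Store → Prop} {σ : Store} (hx : 17 < x)
    (hv : σ.var x = v) (hvZ : v < 2 ^ Z) (h2 : σ.stack 2 = r) (hc : σ.var 17 = c)
    (hcZ : c < 2 ^ Z) (hZ : 1 ≤ Z)
    (hQ : ∀ τ : Store, τ.stack 2 = ([v].filter (1 < ·)).reverse ++ r →
      (∀ s, s ≠ 2 → τ.stack s = σ.stack s) → τ.var 17 = c + ([v].filter (1 < ·)).length →
      Frame 15 σ τ → (∀ i, 17 < i → τ.var i = σ.var i) → Q τ) :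
    (pushIfProg x).Good Z Q σ := by
  have h1 : 1 < 2 ^ Z := lt_two_pow_of_le hZ
  have hx16 : x ≠ 16 := by omega
  have hx15 : x ≠ 15 := by omega
  simp [pushIfProg, hv, h2, hc, hx15, hx16]
  refine ⟨hvZ, by omega, by omega, fun h => ⟨hvZ, hcZ, by omega, ?_⟩, fun h => ?_⟩
  · apply hQ <;> simp [h, Frame.refl]
    · intro s hs hs'
      omega
    · intro i hi
      rw [if_neg (by omega), if_neg (by omega), if_neg (by omega)]
  · have h' : ¬ 1 < v := by omega
    apply hQ <;> simp [h', h2, hc, Frame.refl]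
    intro i hi
    rw [if_neg (by omega), if_neg (by omega)]

/-- The outcome of the two searches in a list. -/
def IsStepData (l : List ℕ) (d : ℕ × ℕ × ℕ × ℕ × ℕ) : Prop :=
  (d = (0, 0, 1, 1, 1) ∧ l.Pairwise Nat.Coprime ∧ ∀ x ∈ l, ∀ q e, 2 ≤ e → x ≠ q ^ e) ∨
    IsPairData l d ∨ (IsRootData l d ∧ l.Pairwise Nat.Coprime)

/-- The list that results from the outcome of the two searches. -/
def stepList (l : List ℕ) (d : ℕ × ℕ × ℕ × ℕ × ℕ) : List ℕ :=
  l.filter (fun x => x ≠ d.1 ∧ x ≠ d.2.1) ++ [d.2.2.1, d.2.2.2.1, d.2.2.2.2].filter (1 < ·)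

/-- One step of the reduction of the list on stack `1`, whose length is variable `10`. -/
def stepProg : Prog :=
  .const 21 0 ;; .const 22 0 ;; .const 23 1 ;; .const 24 1 ;; .const 25 1 ;;
  rootPassProg ;; pairPassProg ;; filterProg ;; pushIfProg 23 ;; pushIfProg 24 ;; pushIfProg 25 ;;
  copyProg 10 17 ;; moveProg 10 20 2 1

theorem IsPairData.perm {l l' : List ℕ} {d : ℕ × ℕ × ℕ × ℕ × ℕ} (h : IsPairData l d)
    (hl : l'.Perm l) : IsPairData l' d := by
  obtain ⟨a, b, rest, h1, h2, h3⟩ := h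
  exact ⟨a, b, rest, hl.trans h1, h2, h3⟩

theorem IsStepData.bounds {l : List ℕ} {d : ℕ × ℕ × ℕ × ℕ × ℕ} {m : ℕ} (h : IsStepData l d)
    (hm : 1 ≤ m) (hlm : ∀ x ∈ l, x < 2 ^ m) :
    d.1 < 2 ^ m ∧ d.2.1 < 2 ^ m ∧ d.2.2.1 < 2 ^ m ∧ d.2.2.2.1 < 2 ^ m ∧ d.2.2.2.2 < 2 ^ m := by
  have h1 : 1 < 2 ^ m := lt_two_pow_of_le hm
  rcases h with ⟨rfl, -⟩ | ⟨a, b, rest, hp, hg, rfl⟩ | ⟨⟨q, e, he, hq, rfl⟩, -⟩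
  · simp
    omega
  · have ha := hlm a (hp.mem_iff.2 (by simp))
    have hb := hlm b (hp.mem_iff.2 (by simp))
    refine ⟨ha, hb, ?_, (Nat.div_le_self _ _).trans_lt ha, (Nat.div_le_self _ _).trans_lt hb⟩
    rcases Nat.eq_zero_or_pos a with rfl | h0
    · simpa using hb
    · exact (Nat.gcd_le_left b h0).trans_lt ha
  · have := hlm _ hq
    exact ⟨this, this, (Nat.le_self_pow (by omega) _).trans_lt this, h1, h1⟩

/-- The order of the two searches matters: a pair overwrites a root, so a root is acted upon only in
a pairwise coprime list. `reflTransGen_stepList` relies on this. -/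
theorem stepProg_good {Z m : ℕ} {l : List ℕ} {Q : Store → Prop} {σ : Store}
    (hl : σ.stack 1 = l) (hn : σ.var 10 = l.length) (hnZ : l.length + 3 < Z)
    (h2 : σ.stack 2 = []) (h3 : σ.stack 3 = []) (hl2 : ∀ x ∈ l, 2 ≤ x)
    (hlm : ∀ x ∈ l, x < 2 ^ m) (hm : 1 ≤ m) (hZ : (m + 2) * (m + 2) ≤ Z)
    (hQ : ∀ (τ : Store) (d : ℕ × ℕ × ℕ × ℕ × ℕ), IsStepData l d → τ.stack 1 = stepList l d →
      τ.var 10 = (stepList l d).length → τ.stack 2 = [] → τ.stack 3 = [] →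
      τ.stack 0 = σ.stack 0 → Frame 10 σ τ → Q τ) :
    stepProg.Good Z Q σ := by
  have hmZ : m + 2 < Z := by nlinarith
  have hWZ : 2 ^ m ≤ 2 ^ Z := Nat.pow_le_pow_right (by norm_num) (by omega)
  have hZZ : Z < 2 ^ Z := Nat.lt_two_pow_self
  simp only [stepProg, good_seq, good_const]
  refine rootPassProg_good (m := m) (l := l) (by simpa using hl) (by simpa using hn) (by omega)
    (by simpa using h2) hl2 hlm hZ ?_
  rintro τ ⟨a1, a2, a3, a4, a5⟩
  simp at a3 a4
  have hmem : ∀ x ∈ l.reverse, x ∈ l := fun x hx => List.mem_reverse.1 hx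
  refine pairPassProg_good (m := m) (l := l.reverse) a2 ?_ (by simp; omega) a1
    (by rw [a3 3 (by norm_num) (by norm_num), h3]) (fun x hx => hl2 x (hmem x hx))
    (fun x hx => hlm x (hmem x hx)) hZ ?_
  · rw [a4 10 (by norm_num), List.length_reverse, ← hn]
    simp
  rintro υ ⟨b1, b2, b3, b4, -, b6⟩
  rw [List.reverse_reverse] at b1
  have hd : IsStepData l υ.data := by
    rcases b6 with ⟨b6, b7⟩ | b6
    · have hcop : l.Pairwise Nat.Coprime := by
        have := b7 List.Pairwise.nil
        rw [List.pairwise_reverse] at this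
        exact this.imp fun h => h.symm
      rw [b6]
      rcases a5 with ⟨a5, a6⟩ | a5
      · left
        refine ⟨?_, hcop, a6⟩
        rw [a5]
        simp [Store.data]
      · exact Or.inr (Or.inr ⟨a5, hcop⟩)
    · exact Or.inr (Or.inl (b6.perm (List.reverse_perm l).symm))
  have hbd := hd.bounds hm hlm
  generalize hdd : υ.data = d at hd hbd
  obtain ⟨A, B, u, v, w⟩ := d
  simp [Store.data] at hdd hbd
  obtain ⟨d1, d2, d3, d4, d5⟩ := hdd
  have h10 : υ.var 10 = l.length := by
    rw [b4 10 (by norm_num), a4 10 (by norm_num), ← hn]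
    simp
  refine filterProg_good (m := m) (l := l) b1 h10 (by omega) b2 hlm (by omega) (by omega)
    (by nlinarith) ?_
  rintro ρ ⟨c1, c2, c3, c4, c5, c6⟩
  simp [Store.data, d1, d2, d3, d4, d5] at c5
  rw [d1, d2] at c2 c6
  obtain ⟨e1, e2, e3, e4, e5⟩ := c5
  have hcount := List.length_filter_le (fun x => decide (x ≠ A ∧ x ≠ B)) l
  have hone : ∀ y : ℕ, ([y].filter (1 < ·)).length ≤ 1 := fun y =>
    (List.length_filter_le _ _).trans (by simp)
  have hu := hone u
  have hv := hone v
  have hw := hone w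
  refine pushIfProg_good (by norm_num) e3 (by omega) c2 c6 (by omega) (by omega) ?_
  intro ρ1 f1 f2 f3 f4 f5
  refine pushIfProg_good (by norm_num) ((f5 24 (by norm_num)).trans e4) (by omega) f1 f3 (by omega)
    (by omega) ?_
  intro ρ2 g1 g2 g3 g4 g5
  refine pushIfProg_good (by norm_num)
    ((g5 25 (by norm_num)).trans ((f5 25 (by norm_num)).trans e5)) (by omega) g1 g3 (by omega)
    (by omega) ?_
  intro ρ3 k1 k2 k3 k4 k5
  have hlist : stepList l (A, B, u, v, w) = l.filter (fun x => x ≠ A ∧ x ≠ B) ++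
      ([u].filter (1 < ·) ++ ([v].filter (1 < ·) ++ [w].filter (1 < ·))) := by
    rw [← List.filter_append, ← List.filter_append]
    rfl
  have k1' : ρ3.stack 2 = (stepList l (A, B, u, v, w)).reverse := by
    rw [k1, hlist]
    simp only [List.reverse_append, List.append_assoc]
  have k3' : ρ3.var 17 = (stepList l (A, B, u, v, w)).length := by
    rw [k3, hlist]
    simp only [List.length_append, add_assoc]
  have hlen : (stepList l (A, B, u, v, w)).length < Z := by omega
  simp [k3']
  refine ⟨by omega, moveProg_good (by norm_num) (by simpa using k1') (by simp)
    (by simpa using hlen.le) ?_ ?_⟩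
  · intro x hx
    simp only [List.mem_reverse, stepList, List.mem_append, List.mem_filter] at hx
    rcases hx with hx | hx
    · exact (hlm x hx.1).trans_le hWZ
    · simp at hx
      omega
  · intro ξ i1 i2 i3 i4
    simp only [Store.set_stack] at i2 i3
    have hst : ∀ t, t ≠ 1 → t ≠ 2 → ξ.stack t = σ.stack t := by
      intro t ht ht'
      rw [i3 t ht' ht, k2 t ht', g2 t ht', f2 t ht', c3 t ht ht', b3 t ht ht', a3 t ht ht']
    refine hQ ξ (A, B, u, v, w) hd ?_ ?_ i1 ?_ ?_ ?_
    · rw [i2, List.reverse_reverse, k2 1 (by norm_num), g2 1 (by norm_num), f2 1 (by norm_num), c1,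
        List.append_nil]
    · rw [i4 10 (by norm_num)]
      simp
    · rw [hst 3 (by norm_num) (by norm_num), h3]
    · exact hst 0 (by norm_num) (by norm_num)
    · intro i hi
      rw [i4 i (by omega)]
      simp
      rw [if_neg (by omega), k4 i (by omega), g4 i (by omega), f4 i (by omega), c4 i (by omega),
        b4 i (by omega), a4 i (by omega)]
      simp
      split_ifs <;> first | rfl | omega

/-! ### The reduction of a list -/

theorem prod_filter_le {l : List ℕ} (hl : ∀ x ∈ l, 2 ≤ x) (p : ℕ → Bool) :
    (l.filter p).prod ≤ l.prod := by
  refine Nat.le_of_dvd (List.prod_pos fun x hx => ?_) List.filter_sublist.prod_dvd_prod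
  have := hl x hx
  omega

theorem prod_filter_one_lt {l : List ℕ} (hl : ∀ x ∈ l, 0 < x) :
    (l.filter (1 < ·)).prod = l.prod := by
  induction l with
  | nil => rfl
  | cons a l ih =>
    have ha := hl a (by simp)
    have ih := ih fun x hx => hl x (by simp [hx])
    rw [List.filter_cons]
    split_ifs with h
    · simp [ih]
    · have : a = 1 := by simp at h; omega
      simp [ih, this]

/-- The list is pairwise coprime and contains no perfect power. -/
def IsDone (l : List ℕ) : Prop :=
  l.Pairwise Nat.Coprime ∧ ∀ x ∈ l, ∀ q e, 2 ≤ e → x ≠ q ^ e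

instance : Std.Symm Nat.Coprime := ⟨fun _ _ h => h.symm⟩

theorem IsDone.isReduced {l : List ℕ} (h : IsDone l) : IsReduced l.toFinset := by
  refine ⟨fun a ha b hb hab => ?_, fun a ha q e he => h.2 a (List.mem_toFinset.1 ha) q e he⟩
  rw [List.mem_toFinset] at ha hb
  exact h.1.forall ha hb hab

/-- Keeps the product of a reduced list of divisors at most `N`. After a further divisor is added it
is at most `N ^ 2 < 2 ^ (2 * m)`, which bounds the next reduction. -/
theorem prod_dvd_of_pairwise_coprime {l : List ℕ} {N : ℕ} (h : l.Pairwise Nat.Coprime)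
    (hN : ∀ x ∈ l, x ∣ N) : l.prod ∣ N := by
  induction l with
  | nil => simp
  | cons a l ih =>
    rw [List.pairwise_cons] at h
    rw [List.prod_cons]
    refine Nat.Coprime.mul_dvd_of_dvd_of_dvd (Nat.coprime_list_prod_right_iff.2 h.1)
      (hN a (by simp)) (ih h.2 fun x hx => hN x (by simp [hx]))

/-- The initial data encode that nothing happens: `0` is not in the list, and the entries `1` are
never pushed. -/
theorem stepList_zero {l : List ℕ} (hl : ∀ x ∈ l, 2 ≤ x) : stepList l (0, 0, 1, 1, 1) = l := by
  have : l.filter (fun x => x ≠ 0 ∧ x ≠ 0) = l := by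
    rw [List.filter_eq_self]
    intro x hx
    have := hl x hx
    simp
    omega
  simp only [stepList, this]
  simp

/-- Lets the reduction run for a fixed number of passes, those after the last effective one being
idle. -/
theorem IsDone.stepList_eq {l : List ℕ} {d : ℕ × ℕ × ℕ × ℕ × ℕ} (hl : ∀ x ∈ l, 2 ≤ x)
    (h : IsDone l) (hd : IsStepData l d) : stepList l d = l := by
  rcases hd with ⟨rfl, -⟩ | ⟨a, b, rest, hp, hg, rfl⟩ | ⟨⟨q, e, he, hq, rfl⟩, -⟩
  · exact stepList_zero hl
  · have := (hp.pairwise_iff fun h => Nat.Coprime.symm h).1 h.1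
    rw [List.pairwise_cons] at this
    exact absurd (this.1 b (by simp)) hg
  · exact absurd rfl (h.2 _ hq q e he)

theorem mem_stepList {l : List ℕ} {A B u v w x : ℕ} : x ∈ stepList l (A, B, u, v, w) ↔
    (x ∈ l ∧ x ≠ A ∧ x ≠ B) ∨ ((x = u ∨ x = v ∨ x = w) ∧ 1 < x) := by
  simp [stepList, List.mem_filter]

theorem two_le_of_mem_stepList {l : List ℕ} {d : ℕ × ℕ × ℕ × ℕ × ℕ} (hl : ∀ x ∈ l, 2 ≤ x) :
    ∀ x ∈ stepList l d, 2 ≤ x := by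
  obtain ⟨A, B, u, v, w⟩ := d
  intro x hx
  rcases mem_stepList.1 hx with h | h
  · exact hl x h.1
  · exact h.2

theorem dvd_of_mem_stepList {l : List ℕ} {d : ℕ × ℕ × ℕ × ℕ × ℕ} {N : ℕ} (hd : IsStepData l d)
    (hl : ∀ x ∈ l, x ∣ N) : ∀ x ∈ stepList l d, x ∣ N := by
  intro x hx
  rcases hd with ⟨rfl, -⟩ | ⟨a, b, rest, hp, hg, rfl⟩ | ⟨⟨q, e, he, hq, rfl⟩, -⟩
  · rcases mem_stepList.1 hx with h | h
    · exact hl x h.1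
    · omega
  · have ha := hl a (hp.mem_iff.2 (by simp))
    have hb := hl b (hp.mem_iff.2 (by simp))
    rcases mem_stepList.1 hx with h | ⟨rfl | rfl | rfl, -⟩
    · exact hl x h.1
    · exact (Nat.gcd_dvd_left a b).trans ha
    · exact (Nat.div_dvd_of_dvd (Nat.gcd_dvd_left a b)).trans ha
    · exact (Nat.div_dvd_of_dvd (Nat.gcd_dvd_right a b)).trans hb
  · rcases mem_stepList.1 hx with h | ⟨rfl | rfl | rfl, h⟩
    · exact hl x h.1
    · exact (dvd_pow_self x (by omega)).trans (hl _ hq)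
    · omega
    · omega

theorem two_le_of_two_le_pow {q e : ℕ} (he : 2 ≤ e) (h : 2 ≤ q ^ e) : 2 ≤ q := by
  by_contra hq
  interval_cases q
  · rw [zero_pow (by omega)] at h
    omega
  · simp at h

/-- The product is the potential that drives the reduction. For a pair with greatest common divisor
`g ≥ 2`, the factor `a * b` becomes `a * b / g`; for a perfect power, `q ^ e` becomes `q`, and `q ^
e ≥ 2 * q`. Removing further copies only lowers the product. -/
theorem prod_stepList_le {l : List ℕ} {d : ℕ × ℕ × ℕ × ℕ × ℕ} (hl : ∀ x ∈ l, 2 ≤ x)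
    (hd : IsStepData l d) : IsDone l ∨ 2 * (stepList l d).prod ≤ l.prod := by
  rcases hd with ⟨-, h⟩ | ⟨a, b, rest, hp, hg, rfl⟩ | ⟨⟨q, e, he, hq, rfl⟩, -⟩
  · exact Or.inl h
  · right
    have ha := hl a (hp.mem_iff.2 (by simp))
    have hb := hl b (hp.mem_iff.2 (by simp))
    have hrest : ∀ x ∈ rest, 2 ≤ x := fun x hx => hl x (hp.mem_iff.2 (by simp [hx]))
    have hg0 : 0 < a.gcd b := Nat.gcd_pos_of_pos_left b (by omega)
    have hag := Nat.mul_div_cancel' (Nat.gcd_dvd_left a b)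
    have hbg := Nat.mul_div_cancel' (Nat.gcd_dvd_right a b)
    have ha0 : 0 < a / a.gcd b := Nat.div_pos (Nat.gcd_le_left b (by omega)) hg0
    have hb0 : 0 < b / a.gcd b := Nat.div_pos (Nat.gcd_le_right a (by omega)) hg0
    simp only [stepList, List.prod_append]
    rw [prod_filter_one_lt (by
      simp only [List.mem_cons, List.not_mem_nil, or_false, forall_eq_or_imp, forall_eq]; omega),
      (hp.filter _).prod_eq, hp.prod_eq]
    have hf : (a :: b :: rest).filter (fun x => decide (x ≠ a ∧ x ≠ b)) =
        rest.filter (fun x => decide (x ≠ a ∧ x ≠ b)) := by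
      simp
    rw [hf]
    have h1 := prod_filter_le hrest fun x => decide (x ≠ a ∧ x ≠ b)
    have h2 : 2 * (b / a.gcd b) ≤ b := by
      calc _ ≤ a.gcd b * (b / a.gcd b) := Nat.mul_le_mul_right _ (by omega)
        _ = b := hbg
    simp only [List.prod_cons, List.prod_nil, mul_one]
    calc _ = (rest.filter fun x => decide (x ≠ a ∧ x ≠ b)).prod *
          (a.gcd b * (a / a.gcd b) * (2 * (b / a.gcd b))) := by ring
      _ ≤ rest.prod * (a * b) :=
        Nat.mul_le_mul h1 (Nat.mul_le_mul hag.le h2)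
      _ = _ := by ring
  · right
    have hq2 := two_le_of_two_le_pow he (hl _ hq)
    have hp := List.perm_cons_erase hq
    have hrest : ∀ x ∈ l.erase (q ^ e), 2 ≤ x := fun x hx => hl x (List.mem_of_mem_erase hx)
    simp only [stepList, List.prod_append]
    rw [prod_filter_one_lt (by simp; omega), (hp.filter _).prod_eq, hp.prod_eq]
    have hf : (q ^ e :: l.erase (q ^ e)).filter (fun x => decide (x ≠ q ^ e ∧ x ≠ q ^ e)) =
        (l.erase (q ^ e)).filter (fun x => decide (x ≠ q ^ e ∧ x ≠ q ^ e)) := by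
      simp
    rw [hf]
    have h1 := prod_filter_le hrest fun x => decide (x ≠ q ^ e ∧ x ≠ q ^ e)
    have h2 : 2 * q ≤ q ^ e := by
      calc 2 * q ≤ q * q := Nat.mul_le_mul_right _ hq2
        _ = q ^ 2 := (pow_two q).symm
        _ ≤ q ^ e := Nat.pow_le_pow_right (by omega) he
    simp only [List.prod_cons, List.prod_nil, mul_one]
    calc _ = ((l.erase (q ^ e)).filter fun x => decide (x ≠ q ^ e ∧ x ≠ q ^ e)).prod *
          (2 * q) := by ring
      _ ≤ (l.erase (q ^ e)).prod * q ^ e := Nat.mul_le_mul h1 h2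
      _ = _ := by ring

/-- The program replaces `q ^ e` by `q`, whereas the reduction rule only adds `q`. Splitting the
pair `q ^ (j + 1)`, `q` yields `q`, `q ^ j` and `1`, so repeated splits wear the power down. The
powers are assumed absent from `S`, as a split would remove them from it. -/
theorem reduceStep_root_chain {S : Finset ℕ} {q e : ℕ} (hq : 2 ≤ q) (h1 : 1 ∉ S)
    (hS : ∀ j, 2 ≤ j → j ≤ e → q ^ j ∉ S) {j : ℕ} (hj : 1 ≤ j) (hje : j ≤ e) :
    Relation.ReflTransGen ReduceStep (insert (q ^ j) (insert q S)) (insert q S) := by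
  induction j, hj using Nat.le_induction with
  | base => simpa using Relation.ReflTransGen.refl
  | succ j hj ih =>
    have hlt : q < q ^ (j + 1) := lt_self_pow₀ (by omega) (by omega)
    have hgcd : (q ^ (j + 1)).gcd q = q := Nat.gcd_eq_right (dvd_pow_self q (by omega))
    have hdiv : q ^ (j + 1) / q = q ^ j := by
      rw [pow_succ, Nat.mul_div_cancel _ (by omega)]
    have hqj : 1 < q ^ j := Nat.one_lt_pow (by omega) (by omega)
    have step := ReduceStep.split (insert (q ^ (j + 1)) (insert q S)) (q ^ (j + 1)) q (by simp)
      (by simp) (by omega) (by omega)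
    rw [hgcd, hdiv, Nat.div_self (by omega)] at step
    refine Relation.ReflTransGen.head step ?_
    convert ih (by omega) using 1
    have hSj := hS (j + 1) (by omega) hje
    ext x
    simp only [Finset.mem_erase, Finset.mem_union, Finset.mem_insert, Finset.mem_singleton]
    constructor
    · rintro ⟨h2, (h3 | h3)⟩
      · tauto
      · tauto
    · rintro (rfl | rfl | hx)
      · exact ⟨by omega, by tauto⟩
      · exact ⟨by omega, by tauto⟩
      · have h2 : x ≠ 1 := fun h => h1 (h ▸ hx)
        have h3 : x ≠ q ^ (j + 1) := fun h => hSj (h ▸ hx)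
        tauto

/-- A step on the list amounts to no reduction step, if nothing was found or two equal entries
merge; to one split; or to one root step followed by a chain of splits. -/
theorem reflTransGen_stepList {l : List ℕ} {d : ℕ × ℕ × ℕ × ℕ × ℕ} (hl : ∀ x ∈ l, 2 ≤ x)
    (hd : IsStepData l d) :
    Relation.ReflTransGen ReduceStep l.toFinset (stepList l d).toFinset := by
  rcases hd with ⟨rfl, -⟩ | ⟨a, b, rest, hp, hg, rfl⟩ | ⟨⟨q, e, he, hq, rfl⟩, hcop⟩
  · rw [stepList_zero hl]
  · have ha := hp.mem_iff.2 (by simp : a ∈ a :: b :: rest)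
    have hb := hp.mem_iff.2 (by simp : b ∈ a :: b :: rest)
    have ha2 := hl a ha
    have hb2 := hl b hb
    have hg0 : 0 < a.gcd b := Nat.gcd_pos_of_pos_left b (by omega)
    have ha0 : 0 < a / a.gcd b := Nat.div_pos (Nat.gcd_le_left b (by omega)) hg0
    have hb0 : 0 < b / a.gcd b := Nat.div_pos (Nat.gcd_le_right a (by omega)) hg0
    by_cases hab : a = b
    · subst hab
      have : (stepList l (a, a, a.gcd a, a / a.gcd a, a / a.gcd a)).toFinset = l.toFinset := by
        ext x
        rw [Nat.gcd_self, Nat.div_self (by omega), List.mem_toFinset, mem_stepList,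
          List.mem_toFinset]
        constructor
        · rintro (h | ⟨rfl | h | h, h'⟩)
          · exact h.1
          · exact ha
          · omega
          · omega
        · intro hx
          have := hl x hx
          by_cases hxa : x = a
          · right; omega
          · left; exact ⟨hx, hxa, hxa⟩
      rw [this]
    · refine Relation.ReflTransGen.single ?_
      convert ReduceStep.split l.toFinset a b (by simpa) (by simpa) hab hg using 1
      ext x
      rw [List.mem_toFinset, mem_stepList]
      simp only [Finset.mem_erase, Finset.mem_union, Finset.mem_insert, Finset.mem_singleton,
        List.mem_toFinset]
      constructor
      · rintro (⟨h1, h2, h3⟩ | ⟨h1, h2⟩)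
        · have := hl x h1
          exact ⟨by omega, by tauto⟩
        · exact ⟨by omega, by tauto⟩
      · rintro ⟨h1, (⟨h2, h3, h4⟩ | h2)⟩
        · tauto
        · right
          exact ⟨h2, by omega⟩
  · have hq2 := two_le_of_two_le_pow he (hl _ hq)
    have h1 : 1 ∉ l.toFinset.erase (q ^ e) := by
      simp only [Finset.mem_erase, List.mem_toFinset, not_and]
      intro _ h
      have := hl 1 h
      omega
    have h2 : ∀ j, 2 ≤ j → j ≤ e → q ^ j ∉ l.toFinset.erase (q ^ e) := by
      intro j hj hje h
      rw [Finset.mem_erase, List.mem_toFinset] at h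
      -- In a pairwise coprime list no other power of `q` can accompany `q ^ e`.
      have h3 : Nat.Coprime (q ^ j) (q ^ e) := hcop.forall h.2 hq h.1
      rw [Nat.coprime_pow_left_iff (by omega), Nat.coprime_pow_right_iff (by omega),
        Nat.coprime_self] at h3
      omega
    have h3 := reduceStep_root_chain hq2 h1 h2 (by omega) le_rfl
    rw [Finset.insert_comm, Finset.insert_erase (by simpa)] at h3
    have h4 := Relation.ReflTransGen.head (ReduceStep.root l.toFinset q e he (by simpa)) h3
    convert h4 using 1
    ext x
    rw [List.mem_toFinset, mem_stepList]
    simp only [Finset.mem_erase, Finset.mem_insert, List.mem_toFinset]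
    constructor
    · rintro (h | ⟨h | h | h, h'⟩)
      · tauto
      · tauto
      · omega
      · omega
    · rintro (rfl | h)
      · right; omega
      · left; tauto

/-- The list on stack `1` is reduced, by as many steps as variable `9` says. -/
def reduceProg : Prog := .loop 9 stepProg

/-- The list `l` of divisors of `N` is on stack `1`, and its length is variable `10`. -/
structure HoldsList (N : ℕ) (l : List ℕ) (τ : Store) : Prop where
  stack_one : τ.stack 1 = l
  length : τ.var 10 = l.length
  stack_two : τ.stack 2 = []
  stack_three : τ.stack 3 = []
  two_le : ∀ x ∈ l, 2 ≤ x
  dvd : ∀ x ∈ l, x ∣ N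

/-- The state of the reduction of the list `l` after `i` passes. -/
structure ReduceInv (N : ℕ) (l : List ℕ) (σ : Store) (i : ℕ) (τ : Store) : Prop where
  holds : HoldsList N (τ.stack 1) τ
  reach : Relation.ReflTransGen ReduceStep l.toFinset (τ.stack 1).toFinset
  prod_le : (τ.stack 1).prod ≤ l.prod
  done : IsDone (τ.stack 1) ∨ (τ.stack 1).prod * 2 ^ i ≤ l.prod
  stack : τ.stack 0 = σ.stack 0
  frame : Frame 10 σ τ

/-- The product starts below `2 ^ (2 * m)`, stays positive and at least halves until the list is
reduced, so `2 * m` passes suffice. -/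
theorem reduceProg_good {Z m N : ℕ} {l : List ℕ} {Q : Store → Prop} {σ : Store}
    (hl : HoldsList N l σ) (hN0 : 0 < N) (hN : N < 2 ^ m) (hm : 1 ≤ m) (hK : σ.var 9 = 2 * m)
    (hprod : l.prod < 2 ^ (2 * m)) (hZ : (m + 2) * (m + 2) ≤ Z)
    (hQ : ∀ (τ : Store) (l' : List ℕ), HoldsList N l' τ → ReducesTo l.toFinset l'.toFinset →
      l'.prod ∣ N → τ.stack 0 = σ.stack 0 → Frame 10 σ τ → Q τ) :
    reduceProg.Good Z Q σ := by
  refine good_loop (ReduceInv N l σ) (by nlinarith) ?_ ?_ ?_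
  · constructor <;> simp [hl.stack_one, Frame.refl, hl, Relation.ReflTransGen.refl]
  · rintro i - τ ⟨h1, h2, h3, h4, h5, h6⟩
    set l₁ := τ.stack 1 with hl₁
    -- All entries are at least `2`, so the product also bounds the length.
    have hlen : l₁.length < 2 * m := by
      have h7 : 2 ^ l₁.length ≤ l₁.prod := by
        have := List.pow_card_le_prod (l := l₁) (n := 2) h1.two_le
        simpa using this
      exact (Nat.pow_lt_pow_iff_right (by norm_num)).1 (h7.trans_lt (h3.trans_lt hprod))
    refine stepProg_good (m := m) hl₁.symm h1.length (by nlinarith) h1.stack_two h1.stack_three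
      h1.two_le (fun x hx => (Nat.le_of_dvd hN0 (h1.dvd x hx)).trans_lt hN) hm hZ ?_
    intro υ d hd k1 k2 k3 k4 k5 k6
    constructor
    · rw [k1]
      exact ⟨k1, k2, k3, k4, two_le_of_mem_stepList h1.two_le, dvd_of_mem_stepList hd h1.dvd⟩
    · rw [k1]
      exact h2.trans (reflTransGen_stepList h1.two_le hd)
    · rw [k1]
      rcases prod_stepList_le h1.two_le hd with h | h
      · rw [h.stepList_eq h1.two_le hd]
        exact h3
      · omega
    · rw [k1]
      rcases prod_stepList_le h1.two_le hd with h | h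
      · rw [h.stepList_eq h1.two_le hd]
        exact Or.inl h
      · rcases h4 with h4 | h4
        · rw [h4.stepList_eq h1.two_le hd]
          exact Or.inl h4
        · right
          rw [pow_succ]
          calc _ = 2 * (stepList l₁ d).prod * 2 ^ i := by ring
            _ ≤ l₁.prod * 2 ^ i := Nat.mul_le_mul_right _ h
            _ ≤ _ := h4
    · rw [k5, h5]
    · exact h6.trans k6
  · rw [hK]
    rintro τ ⟨h1, h2, h3, h4, h5, h6⟩
    have hdone : IsDone (τ.stack 1) := by
      rcases h4 with h4 | h4
      · exact h4
      · have h7 : 0 < (τ.stack 1).prod := List.prod_pos fun x hx => by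
          have := h1.two_le x hx
          omega
        have h8 := Nat.mul_le_mul_right (2 ^ (2 * m)) h7
        omega
    exact hQ τ _ h1 ⟨h2, hdone.isReduced⟩ (prod_dvd_of_pairwise_coprime hdone.1 h1.dvd) h5 h6

/-! ### The extended order -/

theorem factorization_prod_pow_log {q : ℕ} (hq : q.Prime) (B : ℕ) :
    (∏ p ∈ (Finset.range (B + 1)).filter Nat.Prime, p ^ Nat.log p B).factorization q =
      Nat.log q B := by
  have hp : ∀ p ∈ (Finset.range (B + 1)).filter Nat.Prime, p ^ Nat.log p B ≠ 0 := fun p hp =>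
    pow_ne_zero _ (Finset.mem_filter.1 hp).2.ne_zero
  rw [Nat.factorization_prod_apply hp]
  have h1 : ∀ p ∈ (Finset.range (B + 1)).filter Nat.Prime,
      (p ^ Nat.log p B).factorization q = if p = q then Nat.log q B else 0 := by
    intro p hp
    rw [(Finset.mem_filter.1 hp).2.factorization_pow, Finsupp.single_apply]
    split_ifs with h
    · rw [h]
    · rfl
  rw [Finset.sum_congr rfl h1, Finset.sum_ite_eq']
  split_ifs with h
  · rfl
  -- A prime `q > B` is absent from the product, in agreement with `Nat.log q B = 0`.
  · simp only [Finset.mem_filter, Finset.mem_range, hq, and_true] at h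
    rw [Nat.log_of_lt (by omega)]

theorem prod_pow_log_ne_zero (B : ℕ) :
    ∏ p ∈ (Finset.range (B + 1)).filter Nat.Prime, p ^ Nat.log p B ≠ 0 :=
  Finset.prod_ne_zero_iff.2 fun _ hp => pow_ne_zero _ (Finset.mem_filter.1 hp).2.ne_zero

theorem grownOrder_ne_zero {r : ℕ} (hr : r ≠ 0) (B : ℕ) : grownOrder r B ≠ 0 :=
  mul_ne_zero hr (prod_pow_log_ne_zero B)

theorem factorization_grownOrder {q r : ℕ} (hq : q.Prime) (hr : r ≠ 0) (B : ℕ) :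
    (grownOrder r B).factorization q = r.factorization q + Nat.log q B := by
  rw [grownOrder, Nat.factorization_mul hr (prod_pow_log_ne_zero B), Finsupp.add_apply,
    factorization_prod_pow_log hq]

/-- The least common multiple of the numbers from `1` to `n`. -/
def lcmUpTo : ℕ → ℕ
  | 0 => 1
  | n + 1 => (lcmUpTo n).lcm (n + 1)

theorem lcmUpTo_pos (n : ℕ) : 0 < lcmUpTo n := by
  induction n with
  | zero => exact one_pos
  | succ n ih => exact Nat.lcm_pos ih (Nat.succ_pos n)

theorem lcmUpTo_le_pow {n B : ℕ} (h : n ≤ B) : lcmUpTo n ≤ B ^ n := by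
  induction n with
  | zero => exact le_rfl
  | succ n ih =>
    calc lcmUpTo (n + 1) ≤ lcmUpTo n * (n + 1) :=
          Nat.le_of_dvd (Nat.mul_pos (lcmUpTo_pos n) (Nat.succ_pos n)) (Nat.lcm_dvd_mul _ _)
      _ ≤ B ^ n * B := Nat.mul_le_mul (ih (by omega)) h
      _ = B ^ (n + 1) := (pow_succ B n).symm

theorem dvd_lcmUpTo {i n : ℕ} (hi : 0 < i) (h : i ≤ n) : i ∣ lcmUpTo n := by
  induction n with
  | zero => omega
  | succ n ih =>
    rcases Nat.lt_or_ge n i with hlt | hge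
    · obtain rfl : i = n + 1 := by omega
      exact Nat.dvd_lcm_right _ _
    · exact (ih hge).trans (Nat.dvd_lcm_left _ _)

theorem lcmUpTo_dvd {n a : ℕ} (h : ∀ i, 0 < i → i ≤ n → i ∣ a) : lcmUpTo n ∣ a := by
  induction n with
  | zero => exact one_dvd a
  | succ n ih =>
    exact Nat.lcm_dvd (ih fun i h0 hi => h i h0 (by omega)) (h _ (Nat.succ_pos n) le_rfl)

/-- The prime powers `q ^ η` are pairwise coprime and themselves at most `B`, so their product
divides the least common multiple. Conversely the `q`-part of any `i ≤ B` is at most `B`, hence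
divides `q ^ η`. -/
theorem grownOrder_eq (r B : ℕ) : grownOrder r B = r * lcmUpTo B := by
  rw [grownOrder]
  congr 1
  apply Nat.dvd_antisymm
  · refine Finset.prod_dvd_of_isRelPrime ?_ ?_
    · intro p hp q hq hpq
      have hp' := (Finset.mem_filter.1 hp).2
      have hq' := (Finset.mem_filter.1 hq).2
      exact Nat.coprime_iff_isRelPrime.1 (Nat.coprime_pow_primes _ _ hp' hq' hpq)
    · intro p hp
      rw [Finset.mem_filter, Finset.mem_range] at hp
      refine dvd_lcmUpTo (pow_pos hp.2.pos _) (Nat.pow_log_le_self p ?_)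
      have := hp.2.pos
      omega
  · refine lcmUpTo_dvd fun i h0 hi => ?_
    rw [← Nat.factorization_prime_le_iff_dvd h0.ne' (prod_pow_log_ne_zero B)]
    intro q hq
    rw [factorization_prod_pow_log hq]
    exact (Nat.le_log_of_pow_le hq.one_lt (Nat.ordProj_le q h0.ne')).trans
      (Nat.log_mono_right hi)

theorem oddPart_twoExponent {r' o t : ℕ} (ho : Odd o) (h : o * 2 ^ t = r') :
    oddPart r' = o ∧ twoExponent r' = t := by
  have ho2 : ¬ 2 ∣ o := fun h2 => (Nat.not_even_iff_odd.2 ho) (even_iff_two_dvd.2 h2)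
  have ho0 : o ≠ 0 := by rintro rfl; simp at ho2
  have ht : twoExponent r' = t := by
    rw [twoExponent, ← h, padicValNat.mul ho0 (by positivity), padicValNat.eq_zero_of_not_dvd ho2,
      padicValNat.prime_pow, zero_add]
  refine ⟨?_, ht⟩
  rw [oddPart, ht, ← h, Nat.mul_div_cancel _ (by positivity)]

/-! ### Programs for the extended order, its odd part and modular powers -/

/-- Variable `4` becomes the extended order of `r`, `B`, which are in the variables `1`, `2`. -/
def growProg : Prog :=
  .const 4 1 ;; .const 5 0 ;;
  .loop 2
    (.const 11 1 ;; .arith .add 5 5 11 ;; copyProg 40 4 ;; copyProg 41 5 ;; gcdProg ;;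
      .arith .div 4 4 40 ;; .arith .mul 4 4 5) ;;
  .arith .mul 4 1 4

/-- The state of the computation of the least common multiple. -/
structure GrowInv (σ : Store) (i : ℕ) (τ : Store) : Prop where
  lcm : τ.var 4 = lcmUpTo i
  counter : τ.var 5 = i
  frame : Frame 4 σ τ
  stack : τ.stack = σ.stack

theorem lcmUpTo_lt {i B : ℕ} (hB : 2 ≤ B) (hi : i ≤ B) : lcmUpTo i < 2 ^ (B * B) := by
  calc lcmUpTo i ≤ B ^ i := lcmUpTo_le_pow hi
    _ ≤ B ^ B := Nat.pow_le_pow_right (by omega) hi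
    _ < (2 ^ B) ^ B := Nat.pow_lt_pow_left Nat.lt_two_pow_self (by omega)
    _ = 2 ^ (B * B) := (pow_mul 2 B B).symm

theorem growProg_good {Z r B : ℕ} {Q : Store → Prop} {σ : Store} (hr : σ.var 1 = r)
    (hB : σ.var 2 = B) (hB2 : 4 ≤ B) (hrB : r < 2 ^ B) (hZ : 10 * (B * B) ≤ Z)
    (hQ : ∀ τ : Store, τ.var 4 = grownOrder r B → Frame 4 σ τ → τ.stack = σ.stack → Q τ) :
    growProg.Good Z Q σ := by
  have hBB : B ≤ B * B := Nat.le_mul_self B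
  have hZZ : Z < 2 ^ Z := Nat.lt_two_pow_self
  have hWZ : 2 ^ (B * B) ≤ 2 ^ Z := Nat.pow_le_pow_right (by norm_num) (by omega)
  have hrB' : 2 ^ B ≤ 2 ^ (B * B) := Nat.pow_le_pow_right (by norm_num) hBB
  simp [growProg]
  refine good_loop (GrowInv σ) (by simp; omega) ?_ ?_ ?_
  · constructor <;> simp [lcmUpTo, Frame.refl]
  · rintro i hi τ ⟨h1, h2, h3, h4⟩
    simp [hB] at hi
    have hL := lcmUpTo_lt (by omega) hi.le
    have hL' := lcmUpTo_lt (by omega) (Nat.succ_le_of_lt hi)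
    have hiB : i + 1 < 2 ^ (B * B) := lt_two_pow_of_le (by omega)
    simp [h1, h2]
    refine ⟨by omega, by omega, by omega, by omega, ?_⟩
    refine gcdProg_good (W := B * B) (by simpa using hL) (by simpa using hiB) (by omega) ?_
    simp
    intro υ k1 k2 k3
    have k4 : υ.var 4 = lcmUpTo i := by simpa [h1] using k2 4 (by norm_num)
    have k5 : υ.var 5 = i + 1 := by simpa using k2 5 (by norm_num)
    have hg : (lcmUpTo i).gcd (i + 1) ≤ lcmUpTo i := Nat.gcd_le_left _ (lcmUpTo_pos i)
    have hdiv : lcmUpTo i / (lcmUpTo i).gcd (i + 1) ≤ lcmUpTo i := Nat.div_le_self _ _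
    simp [k1, k4, k5]
    refine ⟨by omega, by omega, by omega, by omega, ?_⟩
    constructor <;> simp [k5, k3, h4]
    · rw [lcmUpTo, Nat.lcm, Nat.div_mul_right_comm (Nat.gcd_dvd_left _ _)]
    · intro j hj
      rw [k2 j (by omega)]
      simp
      rw [if_neg (by omega), if_neg (by omega), if_neg (by omega), if_neg (by omega), h3 j hj]
  · simp [hB]
    rintro τ ⟨h1, h2, h3, h4⟩
    have hL := lcmUpTo_lt (by omega) (le_refl B)
    rw [h3 1 (by norm_num), h1, hr]
    refine ⟨by omega, by omega, ?_⟩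
    apply hQ
    · simp [grownOrder_eq]
    · simpa using h3
    · simpa using h4

/-- Variable `4` is replaced by its odd part, variable `5` becomes the exponent of `2` in it, plus
one. -/
def halveProg : Prog :=
  .const 5 1 ;; .size 11 4 ;;
  .loop 11
    (.const 12 2 ;; .arith .mod 13 4 12 ;;
      .ifPos 13 .skip (.arith .div 4 4 12 ;; .const 12 1 ;; .arith .add 5 5 12))

/-- The state of the removal of the factors `2` after `i` passes. -/
structure HalveInv (a : ℕ) (σ : Store) (i : ℕ) (τ : Store) : Prop where
  mul_eq : ∃ t, τ.var 5 = t + 1 ∧ τ.var 4 * 2 ^ t = a ∧ t ≤ i ∧ (Odd (τ.var 4) ∨ t = i)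
  frame : Frame 4 σ τ
  stack : τ.stack = σ.stack

/-- If the number were still even after `a.size` passes, `2 ^ a.size` would divide `a < 2 ^ a.size`.
The exponent is stored plus one because that is the number of trials `i = 0, …, t`. -/
theorem halveProg_good {Z W a : ℕ} {Q : Store → Prop} {σ : Store} (ha : σ.var 4 = a)
    (ha0 : 0 < a) (hW : a < 2 ^ W) (hZ : W + 2 ≤ Z)
    (hQ : ∀ τ : Store, τ.var 4 = oddPart a → τ.var 5 = twoExponent a + 1 → twoExponent a ≤ W →
      Odd (oddPart a) → oddPart a < 2 ^ W → Frame 4 σ τ → τ.stack = σ.stack → Q τ) :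
    halveProg.Good Z Q σ := by
  have hZZ : Z < 2 ^ Z := Nat.lt_two_pow_self
  have hWZ : 2 ^ W ≤ 2 ^ Z := Nat.pow_le_pow_right (by norm_num) (by omega)
  have hs := Nat.size_le.2 hW
  simp [halveProg, ha]
  refine ⟨by omega, good_loop (HalveInv a σ) (by simp; omega) ?_ ?_ ?_⟩
  · constructor <;> simp [ha, Frame.refl]
  · rintro i hi τ ⟨⟨t, h1, h2, h3, h4⟩, h5, h6⟩
    simp at hi
    have hle : τ.var 4 ≤ a := by
      rw [← h2]
      exact Nat.le_mul_of_pos_right _ (by positivity)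
    simp [h1]
    refine ⟨by omega, by omega, by omega, fun hodd => ?_, fun heven => ?_⟩
    · have hodd' : Odd (τ.var 4) := Nat.odd_iff.2 (by omega)
      refine ⟨⟨t, ?_⟩, ?_, ?_⟩
      · simp [h1, h2, hodd']
        omega
      · simpa using h5
      · simpa using h6
    · refine ⟨by omega, by omega, by omega, by omega, ?_⟩
      have hne : ¬ Odd (τ.var 4) := fun h => by rw [Nat.odd_iff] at h; omega
      refine ⟨⟨t + 1, ?_⟩, ?_, ?_⟩
      · have hti : t = i := by tauto
        simp [hti]
        rw [← h2, pow_succ, hti]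
        have : τ.var 4 = τ.var 4 / 2 * 2 := by omega
        conv_rhs => rw [this]
        ring
      · simpa using h5
      · simpa using h6
  · simp
    rintro τ ⟨⟨t, h1, h2, h3, h4⟩, h5, h6⟩
    have hodd : Odd (τ.var 4) := by
      rcases h4 with h4 | h4
      · exact h4
      · have h7 := Nat.lt_size_self a
        rw [← h4] at h7
        have h8 : 0 < τ.var 4 := Nat.pos_of_ne_zero fun h => by rw [h] at h2; omega
        nlinarith
    obtain ⟨ho, ht⟩ := oddPart_twoExponent hodd h2
    have hle : τ.var 4 ≤ a := by
      rw [← h2]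
      exact Nat.le_mul_of_pos_right _ (by positivity)
    exact hQ τ ho.symm (ht ▸ h1) (by omega) (ho ▸ hodd) (by omega) h5 h6

/-- Variable `6` becomes the power of variable `8` with exponent `4` modulo variable `0`. -/
def powModProg : Prog :=
  .const 6 1 ;; copyProg 11 8 ;; copyProg 12 4 ;; .size 13 4 ;;
  .loop 13
    (.const 14 2 ;; .arith .mod 15 12 14 ;;
      .ifPos 15 (.arith .mul 6 6 11 ;; .arith .mod 6 6 0) .skip ;;
      .arith .mul 11 11 11 ;; .arith .mod 11 11 0 ;; .arith .div 12 12 14)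

/-- The state of the modular exponentiation after `i` passes. -/
structure PowModInv (N x o : ℕ) (σ : Store) (i : ℕ) (τ : Store) : Prop where
  modEq : τ.var 6 * τ.var 11 ^ τ.var 12 ≡ x ^ o [MOD N]
  lt : τ.var 6 < N
  lt' : τ.var 11 < N
  exp : τ.var 12 = o / 2 ^ i
  frame : ∀ j, j < 11 → j ≠ 6 → τ.var j = σ.var j
  stack : τ.stack = σ.stack

/-- Square and multiply: accumulator times base to the remaining exponent stays congruent to `x ^
o`, and the exponent `o / 2 ^ i` is `0` after `o.size` passes. -/
theorem powModProg_good {Z W m N x o : ℕ} {Q : Store → Prop} {σ : Store} (h0 : σ.var 0 = N)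
    (h8 : σ.var 8 = x) (h4 : σ.var 4 = o) (hN1 : 1 < N) (hN : N < 2 ^ m) (hx : x < N)
    (ho : o < 2 ^ W) (hm : 2 * m ≤ Z) (hZ : W + 2 ≤ Z)
    (hQ : ∀ τ : Store, τ.var 6 = x ^ o % N → (∀ j, j < 11 → j ≠ 6 → τ.var j = σ.var j) →
      τ.stack = σ.stack → Q τ) : powModProg.Good Z Q σ := by
  have hZZ : Z < 2 ^ Z := Nat.lt_two_pow_self
  have hWZ : 2 ^ W ≤ 2 ^ Z := Nat.pow_le_pow_right (by norm_num) (by omega)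
  have hmZ : 2 ^ m ≤ 2 ^ Z := Nat.pow_le_pow_right (by norm_num) (by omega)
  have hs := Nat.size_le.2 ho
  have hmul : ∀ {a b : ℕ}, a < N → b < N → a * b < 2 ^ Z := fun {a b} ha hb => by
    calc a * b < 2 ^ m * 2 ^ m := Nat.mul_lt_mul'' (ha.trans hN) (hb.trans hN)
      _ = 2 ^ (2 * m) := by rw [← pow_add, two_mul]
      _ ≤ 2 ^ Z := Nat.pow_le_pow_right (by norm_num) hm
  simp [powModProg, h8, h4]
  refine ⟨by omega, by omega, good_loop (PowModInv N x o σ) (by simp; omega) ?_ ?_ ?_⟩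
  · constructor <;> simp [hN1, hx]
    · exact Nat.ModEq.refl _
    · intro j hj hj'
      split_ifs <;> first | rfl | omega
  · rintro i - τ ⟨k1, k2, k3, k4, k5, k6⟩
    have k0 : τ.var 0 = N := (k5 0 (by norm_num) (by norm_num)).trans h0
    have ho' : τ.var 12 ≤ o := k4 ▸ Nat.div_le_self _ _
    have hexp : o / 2 ^ i / 2 = o / 2 ^ (i + 1) := by rw [pow_succ, Nat.div_div_eq_div_mul]
    have hsq := hmul k3 k3
    have hml := hmul k2 k3
    simp [k0]
    have hsqmod : ∀ e, (τ.var 11 * τ.var 11 % N) ^ e ≡ τ.var 11 ^ (2 * e) [MOD N] := fun e => by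
      rw [pow_mul, pow_two]
      exact (Nat.mod_modEq _ _).pow e
    refine ⟨by omega, by omega, by omega, fun hodd => ?_, fun heven => ?_⟩
    · refine ⟨by omega, by omega, by omega, by omega, by omega, by omega, by omega, by omega,
        by omega, ?_⟩
      constructor <;> simp [k6]
      · have he : τ.var 12 = 2 * (τ.var 12 / 2) + 1 := by omega
        refine Nat.ModEq.trans ?_ k1
        conv_rhs => rw [he, pow_succ]
        calc _ ≡ τ.var 6 * τ.var 11 * τ.var 11 ^ (2 * (τ.var 12 / 2)) [MOD N] :=
              (Nat.mod_modEq _ _).mul (hsqmod _)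
          _ ≡ _ [MOD N] := by rw [mul_assoc, mul_comm (τ.var 11)]
      · exact Nat.mod_lt _ (by omega)
      · exact Nat.mod_lt _ (by omega)
      · rw [k4, hexp]
      · intro j hj hj'
        simp [hj', show j ≠ 11 by omega, show j ≠ 12 by omega, show j ≠ 14 by omega,
          show j ≠ 15 by omega, k5 j hj hj']
    · refine ⟨by omega, by omega, by omega, by omega, by omega, ?_⟩
      constructor <;> try simp [k6, k2]
      · have he : τ.var 12 = 2 * (τ.var 12 / 2) := by omega
        refine Nat.ModEq.trans ?_ k1
        conv_rhs => rw [he]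
        exact (Nat.ModEq.refl _).mul (hsqmod _)
      · exact Nat.mod_lt _ (by omega)
      · rw [k4, hexp]
      · intro j hj hj'
        simp [show j ≠ 11 by omega, show j ≠ 12 by omega, show j ≠ 14 by omega,
          show j ≠ 15 by omega, k5 j hj hj']
  · simp
    rintro τ ⟨k1, k2, k3, k4, k5, k6⟩
    rw [Nat.div_eq_of_lt (Nat.lt_size_self o)] at k4
    rw [k4, pow_zero, mul_one] at k1
    refine hQ τ ?_ k5 k6
    rw [← k1, Nat.mod_eq_of_lt k2]

/-! ### The factoring program -/

theorem Absorbs.append {l l' : List ℕ} {S T U : Finset ℕ} (h : Absorbs l S T)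
    (h' : Absorbs l' T U) : Absorbs (l ++ l') S U := by
  induction l generalizing S with
  | nil =>
    obtain rfl : T = S := h
    exact h'
  | cons a l ih =>
    obtain ⟨S', h1, h2⟩ := h
    exact ⟨S', h1, ih h2⟩

theorem absorbs_singleton {d : ℕ} {S T : Finset ℕ} (h : ReducesTo (insert d S) T) :
    Absorbs [d] S T := ⟨T, h, rfl⟩

/-- The gcd with `N` depends only on the residue modulo `N`. Adding `N` before subtracting `1` stays
within the natural numbers even for `y = 0`. -/
theorem trialGcd_eq {N o x i y : ℕ} (hN : 0 < N) (hy : y = x ^ (2 ^ i * o) % N) :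
    trialGcd N o x i = (y + N - 1).gcd N := by
  have h : ((x : ℤ) ^ (2 ^ i * o) - 1) ≡ ((y + N - 1 : ℕ) : ℤ) [ZMOD N] := by
    have h1 : ((y + N - 1 : ℕ) : ℤ) = (y : ℤ) - 1 + N := by omega
    rw [h1, hy]
    push_cast
    have h2 : (x : ℤ) ^ (2 ^ i * o) - 1 ≡ (x : ℤ) ^ (2 ^ i * o) % N - 1 [ZMOD N] :=
      (Int.mod_modEq _ _).symm.sub_right 1
    exact h2.trans (by simp [Int.ModEq])
  rw [trialGcd, ← Int.gcd_emod, h, Int.gcd_emod, Int.gcd_natCast_natCast]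

/-- The gcd of `y - 1` and `N` is formed, where `y` is variable `6`, and absorbed if it is a
non-trivial factor; then `y` is squared modulo `N`. -/
def trialProg : Prog :=
  .const 11 1 ;; .arith .add 40 6 0 ;; .arith .sub 40 40 11 ;; copyProg 41 0 ;; gcdProg ;;
  .const 11 1 ;; .arith .sub 12 40 11 ;; .arith .sub 13 0 40 ;; .arith .mul 12 12 13 ;;
  .ifPos 12 (.push 1 40 ;; .arith .add 10 10 11 ;; reduceProg) .skip ;;
  .arith .mul 6 6 6 ;; .arith .mod 6 6 0

/-- For a divisor `d` of `N` the tested number `(d - 1) * (N - d)` is positive exactly if `d` is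
non-trivial. The final squaring prepares the exponent of the next trial. -/
theorem trialProg_good {Z m N y : ℕ} {l : List ℕ} {Q : Store → Prop} {σ : Store}
    (hl : HoldsList N l σ) (hprod : l.prod ∣ N) (h0 : σ.var 0 = N) (h6 : σ.var 6 = y) (hy : y < N)
    (hN1 : 1 < N) (hN : N < 2 ^ m) (hK : σ.var 9 = 2 * m) (hm : 1 ≤ m)
    (hZ : (m + 2) * (m + 2) ≤ Z)
    (hQ : ∀ (τ : Store) (l' : List ℕ), HoldsList N l' τ → l'.prod ∣ N →
      Absorbs ([(y + N - 1).gcd N].filter fun d => 1 < d ∧ d < N) l.toFinset l'.toFinset →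
      τ.var 6 = y * y % N → τ.stack 0 = σ.stack 0 → (∀ j, j < 10 → j ≠ 6 → τ.var j = σ.var j) →
      Q τ) : trialProg.Good Z Q σ := by
  have hmm : 3 * m + 3 < Z := by nlinarith
  have hZZ : Z < 2 ^ Z := Nat.lt_two_pow_self
  have hN2 : y + N < 2 ^ (m + 1) := by rw [pow_succ]; omega
  have hmZ : 2 ^ (m + 1) ≤ 2 ^ Z := Nat.pow_le_pow_right (by norm_num) (by omega)
  have hmZ' : 2 ^ m ≤ 2 ^ Z := Nat.pow_le_pow_right (by norm_num) (by omega)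
  have hmul : ∀ {a b : ℕ}, a ≤ N → b ≤ N → a * b < 2 ^ (2 * m) := fun {a b} ha hb => by
    calc a * b < 2 ^ m * 2 ^ m := Nat.mul_lt_mul'' (ha.trans_lt hN) (hb.trans_lt hN)
      _ = 2 ^ (2 * m) := by rw [← pow_add, two_mul]
  have hmulZ : 2 ^ (2 * m) ≤ 2 ^ Z := Nat.pow_le_pow_right (by norm_num) (by omega)
  have hlen : l.length < Z := by
    have h7 : 2 ^ l.length ≤ l.prod := by
      have := List.pow_card_le_prod (l := l) (n := 2) hl.two_le
      simpa using this
    have h8 := (Nat.pow_lt_pow_iff_right (a := 2) (by norm_num)).1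
      (h7.trans_lt ((Nat.le_of_dvd (by omega) hprod).trans_lt hN))
    omega
  simp [trialProg, h0, h6]
  refine ⟨by omega, by omega, by omega, by omega, by omega, ?_⟩
  refine gcdProg_good (W := m + 1) (by simp; omega) (by simp; omega) (by nlinarith) ?_
  simp
  intro υ k1 k2 k3
  set d := (y + N - 1).gcd N with hd
  have hdN : d ∣ N := Nat.gcd_dvd_right _ _
  have hdle : d ≤ N := Nat.le_of_dvd (by omega) hdN
  have hd0 : 0 < d := Nat.gcd_pos_of_pos_right _ (by omega)
  have k0 : υ.var 0 = N := by simpa [h0] using k2 0 (by norm_num)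
  have k6 : υ.var 6 = y := by simpa [h6] using k2 6 (by norm_num)
  have k10 : υ.var 10 = l.length := by simpa [hl.length] using k2 10 (by norm_num)
  have kfr : ∀ j, j < 10 → υ.var j = σ.var j := fun j hj => by
    rw [k2 j (by omega)]
    simp [show j ≠ 41 by omega, show j ≠ 40 by omega, show j ≠ 11 by omega]
  have ht : (d - 1) * (N - d) < 2 ^ (2 * m) := hmul (by omega) (by omega)
  have hyy : y * y < 2 ^ (2 * m) := hmul hy.le hy.le
  simp [k1, k0, k6, k10, k3, hl.stack_one]
  refine ⟨by omega, by omega, by omega, by omega, by omega, by omega, by omega, ?_, ?_⟩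
  · intro hd1 hdlt
    refine ⟨by omega, by omega, by omega, ?_⟩
    have hf : [d].filter (fun d => decide (1 < d ∧ d < N)) = [d] := by
      simp [hd1, hdlt]
    refine reduceProg_good (l := d :: l) (m := m) (N := N) ?_ (by omega) hN hm ?_ ?_ hZ ?_
    · constructor <;> simp [k3, hl.stack_two, hl.stack_three]
      · exact ⟨hd1, hl.two_le⟩
      · exact ⟨hdN, hl.dvd⟩
    · simp [kfr 9, hK]
    · rw [List.prod_cons]
      exact hmul hdle (Nat.le_of_dvd (by omega) hprod)
    · intro τ l' j1 j2 j3 j4 j5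
      have j0 : τ.var 0 = N := by simpa [k0] using j5 0 (by norm_num)
      have j6 : τ.var 6 = y := by simpa [k6] using j5 6 (by norm_num)
      simp [j0, j6]
      refine ⟨by omega, by omega, by omega, ?_⟩
      refine hQ _ l' ?_ j3 ?_ (by simp) ?_ ?_
      · constructor <;> try simp [j1.stack_one, j1.stack_two, j1.stack_three, j1.length]
        · exact j1.two_le
        · exact j1.dvd
      · rw [hf]
        rw [List.toFinset_cons] at j2
        exact absorbs_singleton j2
      · simp [j4, k3]
      · intro j hj hj'
        simp [hj']
        rw [j5 j hj]
        simp [show j ≠ 10 by omega, show j ≠ 11 by omega, show j ≠ 12 by omega,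
          show j ≠ 13 by omega, kfr j hj]
  · intro hdt
    have hf : [d].filter (fun d => decide (1 < d ∧ d < N)) = [] := by
      have : ¬ (1 < d ∧ d < N) := by omega
      simp [this]
    refine ⟨by omega, by omega, by omega, ?_⟩
    refine hQ _ l ?_ hprod ?_ (by simp) ?_ ?_
    · constructor <;> try simp [k3, k10, hl.stack_one, hl.stack_two, hl.stack_three]
      · exact hl.two_le
      · exact hl.dvd
    · rw [hf]
      exact rfl
    · simp [k3]
    · intro j hj hj'
      simp [hj', show j ≠ 11 by omega, show j ≠ 12 by omega,
        show j ≠ 13 by omega, kfr j hj]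

/-- The factoring program. -/
def factorProg : Prog :=
  growProg ;; halveProg ;; .size 9 0 ;; .arith .add 9 9 9 ;; .push 1 0 ;; .const 10 1 ;;
  reduceProg ;; .loop 3 (.pop 8 0 ;; powModProg ;; .loop 5 trialProg)

/-- The values that the factoring program keeps in its variables during the main loop. -/
structure FactorVars (N k a m : ℕ) (τ : Store) : Prop where
  modulus : τ.var 0 = N
  count : τ.var 3 = k
  odd : τ.var 4 = oddPart a
  exponent : τ.var 5 = twoExponent a + 1
  passes : τ.var 9 = 2 * m

theorem FactorVars.congr {N k a m : ℕ} {σ τ : Store} (h : FactorVars N k a m σ)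
    (hτ : ∀ j, j < 10 → j ≠ 6 → j ≠ 8 → τ.var j = σ.var j) : FactorVars N k a m τ := by
  obtain ⟨h1, h2, h3, h4, h5⟩ := h
  constructor <;> rw [hτ _ (by norm_num) (by norm_num) (by norm_num)] <;> assumption

/-- The state of the main loop after `i` trials with the number `x`. -/
structure TrialInv (N k a m x : ℕ) (S : Finset ℕ) (xs : List ℕ) (i : ℕ) (τ : Store) : Prop where
  vars : FactorVars N k a m τ
  holds : HoldsList N (τ.stack 1) τ
  prod_dvd : (τ.stack 1).prod ∣ N
  var_eq : τ.var 6 = x ^ (2 ^ i * oddPart a) % N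
  stack : τ.stack 0 = xs
  absorbs : Absorbs (((List.range i).map (trialGcd N (oddPart a) x)).filter
    fun d => 1 < d ∧ d < N) S (τ.stack 1).toFinset

/-- The state of the main loop. -/
structure FactorInv (N r B k m : ℕ) (S : Finset ℕ) (pre suf : List ℕ) (τ : Store) : Prop where
  vars : FactorVars N k (grownOrder r B) m τ
  holds : HoldsList N (τ.stack 1) τ
  prod_dvd : (τ.stack 1).prod ∣ N
  stack : τ.stack 0 = suf
  absorbs : Absorbs (reports N r B pre) S (τ.stack 1).toFinset

theorem grownOrder_lt {r B : ℕ} (hB : 4 ≤ B) (hr : r < 2 ^ B) :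
    grownOrder r B < 2 ^ (2 * (B * B)) := by
  rw [grownOrder_eq]
  calc r * lcmUpTo B < 2 ^ B * 2 ^ (B * B) := Nat.mul_lt_mul'' hr (lcmUpTo_lt (by omega) le_rfl)
    _ = 2 ^ (B + B * B) := (pow_add _ _ _).symm
    _ ≤ 2 ^ (2 * (B * B)) := Nat.pow_le_pow_right (by norm_num) (by nlinarith)

/-- The specifications are chained, with the run so far expressed by `Absorbs` on the reports of the
finished trials. The largest numbers are `r'`, below `2 ^ (2 * (B * B))`, and the powers in the root
search, so `Z` is of order `B * B` apart from the passes over `xs`. -/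
theorem factorProg_good {Z N r B : ℕ} {xs : List ℕ} (hN1 : 1 < N)
    (hB : 4 ≤ B) (hm : N.size ≤ B) (hr : 0 < r) (hrN : r ≤ N) (hxs : ∀ x ∈ xs, x < N)
    (hZ : 10 * (B * B) ≤ Z) (hk : xs.length ≤ Z) :
    factorProg.Good Z (fun τ => FactoringRun N r B xs (τ.stack 1).toFinset)
      (inputStore N r B xs) := by
  set m := N.size with hmdef
  have hN : N < 2 ^ m := Nat.lt_size_self N
  have hm1 : 1 ≤ m := Nat.size_pos.2 (by omega)
  have hmB : 2 ^ m ≤ 2 ^ B := Nat.pow_le_pow_right (by norm_num) hm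
  have hBB : 4 * B ≤ B * B := Nat.mul_le_mul_right B hB
  have hBZ : 2 ^ B ≤ 2 ^ Z := Nat.pow_le_pow_right (by norm_num) (by omega)
  have hmZ : (m + 2) * (m + 2) ≤ Z := by nlinarith
  have hZZ : Z < 2 ^ Z := Nat.lt_two_pow_self
  have ha0 : 0 < grownOrder r B := Nat.pos_of_ne_zero (grownOrder_ne_zero hr.ne' B)
  have haW : grownOrder r B < 2 ^ (2 * (B * B)) := grownOrder_lt hB (by omega)
  simp only [factorProg, good_seq]
  refine growProg_good (r := r) (B := B) rfl rfl hB (by omega) hZ ?_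
  intro τ₁ a1 a2 a3
  refine halveProg_good a1 ha0 haW (by omega) ?_
  intro τ₂ b1 b2 b3 b4 b5 b6 b7
  have c0 : τ₂.var 0 = N := (b6 0 (by norm_num)).trans (a2 0 (by norm_num))
  have c3 : τ₂.var 3 = xs.length := (b6 3 (by norm_num)).trans (a2 3 (by norm_num))
  have cs : ∀ s, τ₂.stack s = if s = 0 then xs else [] := fun s => by rw [b7, a3]; rfl
  simp [c0, cs, ← hmdef]
  refine ⟨by omega, by omega, by omega, ?_⟩
  refine reduceProg_good (l := [N]) (m := m) (N := N) ?_ (by omega) hN hm1 ?_ ?_ hmZ ?_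
  · constructor <;> simp [cs]
    omega
  · simp [two_mul]
  · simp
    exact hN.trans_le (Nat.pow_le_pow_right (by norm_num) (by omega))
  intro τ₃ S d1 d2 d3 d4 d5
  have dv : FactorVars N xs.length (grownOrder r B) m τ₃ := by
    constructor
    · simpa [c0] using d5 0 (by norm_num)
    · simpa [c3] using d5 3 (by norm_num)
    · simpa [b1] using d5 4 (by norm_num)
    · simpa [b2] using d5 5 (by norm_num)
    · simpa [two_mul] using d5 9 (by norm_num)
  refine good_loop_list xs (FactorInv N r B xs.length m S.toFinset) dv.count hk ?_ ?_ ?_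
  · refine ⟨dv, d1.stack_one.symm ▸ d1, d1.stack_one.symm ▸ d3, ?_, ?_⟩
    · simp [d4, cs]
    · rw [d1.stack_one]
      rfl
  · rintro pre x suf hpre τ ⟨e1, e2, e3, e4, e5⟩
    have hx := hxs x (by simp [hpre])
    simp [e4]
    refine ⟨by omega, ?_⟩
    refine powModProg_good (W := 2 * (B * B)) (m := m) (N := N) (x := x) (o := oddPart (grownOrder r B))
      (by simp [e1.modulus]) (by simp) (by simp [e1.odd]) hN1 hN hx b5 (by nlinarith)
      (by omega) ?_
    simp
    intro υ f1 f2 f3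
    have fv : FactorVars N xs.length (grownOrder r B) m υ := e1.congr fun j hj hj6 hj8 => by
      rw [f2 j (by omega) hj6, if_neg hj8]
    have fs : υ.stack 1 = τ.stack 1 := by rw [f3]; simp
    refine good_loop (TrialInv N xs.length (grownOrder r B) m x (τ.stack 1).toFinset suf) ?_ ?_ ?_ ?_
    · rw [fv.exponent]
      omega
    · refine ⟨fv, ?_, fs ▸ e3, by simpa using f1, by rw [f3]; simp, by rw [fs]; exact rfl⟩
      rw [fs]
      constructor <;> try simp [f3, f2, e2.length, e2.stack_two, e2.stack_three]
      · exact e2.two_le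
      · exact e2.dvd
    · rintro i - ρ ⟨g1, g2, g3, g4, g5, g6⟩
      refine trialProg_good (m := m) g2 g3 g1.modulus g4 (Nat.mod_lt _ (by omega)) hN1 hN g1.passes
        hm1 hmZ ?_
      intro ξ l' h1 h2 h3 h4 h5 h6
      refine ⟨g1.congr fun j hj hj6 _ => h6 j hj hj6, h1.stack_one.symm ▸ h1,
        h1.stack_one.symm ▸ h2, ?_, by rw [h5, g5], ?_⟩
      · rw [h4, ← Nat.mul_mod, ← pow_add]
        congr 2
        ring
      · rw [List.range_succ, List.map_append, List.filter_append, h1.stack_one]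
        refine g6.append ?_
        rw [List.map_singleton, trialGcd_eq (by omega) rfl]
        exact h3
    · rintro ρ ⟨g1, g2, g3, g4, g5, g6⟩
      refine ⟨g1, g2, g3, g5, ?_⟩
      have hrep : reports N r B (pre ++ [x]) = reports N r B pre ++
          ((List.range (twoExponent (grownOrder r B) + 1)).map (trialGcd N (oddPart (grownOrder r B)) x)).filter
            fun d => 1 < d ∧ d < N := by
        simp only [reports, List.flatMap_append, List.flatMap_singleton]
      rw [hrep]
      rw [fv.exponent] at g6
      exact e5.append g6
  · rintro τ ⟨-, -, -, -, e5⟩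
    refine ⟨S.toFinset, ?_, e5⟩
    simpa using d2

/-! ### Final sets -/

/-- A split loses no factor, since `a = g * (a / g)` and `b = g * (b / g)`, and dropping `1` is
harmless in a monoid. So the monoid generated by the set never shrinks. -/
theorem ReduceStep.subset_closure {S T : Finset ℕ} (h : ReduceStep S T) :
    (S : Set ℕ) ⊆ Submonoid.closure (T : Set ℕ) := by
  intro x hx
  cases h with
  | split a b ha hb hab hg =>
    set T := (((S.erase a).erase b) ∪ {a.gcd b, a / a.gcd b, b / a.gcd b}).erase 1 with hT
    have hmem : ∀ y ∈ ((S.erase a).erase b) ∪ {a.gcd b, a / a.gcd b, b / a.gcd b},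
        y ∈ Submonoid.closure (T : Set ℕ) := fun y hy => by
      by_cases h1 : y = 1
      · exact h1 ▸ one_mem _
      · exact Submonoid.subset_closure (Finset.mem_coe.2 (Finset.mem_erase.2 ⟨h1, hy⟩))
    by_cases hxa : x = a
    · rw [hxa, ← Nat.mul_div_cancel' (Nat.gcd_dvd_left a b)]
      exact mul_mem (hmem _ (by simp)) (hmem _ (by simp))
    by_cases hxb : x = b
    · rw [hxb, ← Nat.mul_div_cancel' (Nat.gcd_dvd_right a b)]
      exact mul_mem (hmem _ (by simp)) (hmem _ (by simp))
    · exact hmem x (Finset.mem_union_left _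
        (Finset.mem_erase.2 ⟨hxb, Finset.mem_erase.2 ⟨hxa, hx⟩⟩))
  | root q e he hq =>
    exact Submonoid.subset_closure (Finset.mem_coe.2 (Finset.mem_insert_of_mem hx))

theorem ReduceStep.dvd {S T : Finset ℕ} {N : ℕ} (h : ReduceStep S T) (hS : ∀ x ∈ S, x ∣ N) :
    ∀ x ∈ T, x ∣ N := by
  intro x hx
  cases h with
  | split a b ha hb hab hg =>
    simp only [Finset.mem_erase, Finset.mem_union, Finset.mem_insert, Finset.mem_singleton] at hx
    rcases hx with ⟨-, h | rfl | rfl | rfl⟩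
    · exact hS x h.2.2
    · exact (Nat.gcd_dvd_left a b).trans (hS a ha)
    · exact (Nat.div_dvd_of_dvd (Nat.gcd_dvd_left a b)).trans (hS a ha)
    · exact (Nat.div_dvd_of_dvd (Nat.gcd_dvd_right a b)).trans (hS b hb)
  | root q e he hq =>
    rcases Finset.mem_insert.1 hx with rfl | h
    · exact (dvd_pow_self x (by omega)).trans (hS _ hq)
    · exact hS x h

theorem ReducesTo.closure_le {S T : Finset ℕ} (h : ReducesTo S T) :
    Submonoid.closure (S : Set ℕ) ≤ Submonoid.closure (T : Set ℕ) := by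
  obtain ⟨h, -⟩ := h
  induction h with
  | refl => exact le_rfl
  | tail _ hst ih => exact ih.trans (Submonoid.closure_le.2 hst.subset_closure)

theorem ReducesTo.dvd {S T : Finset ℕ} {N : ℕ} (h : ReducesTo S T) (hS : ∀ x ∈ S, x ∣ N) :
    ∀ x ∈ T, x ∣ N := by
  obtain ⟨h, -⟩ := h
  induction h with
  | refl => exact hS
  | tail _ hst ih => exact hst.dvd ih

theorem Absorbs.final {N : ℕ} {ds : List ℕ} {S T : Finset ℕ} (h : Absorbs ds S T)
    (hS : IsReduced S) (hSN : ∀ x ∈ S, x ∣ N) (hds : ∀ d ∈ ds, d ∣ N) :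
    IsReduced T ∧ (∀ x ∈ T, x ∣ N) ∧
      Submonoid.closure (S : Set ℕ) ≤ Submonoid.closure (T : Set ℕ) ∧
      ∀ d ∈ ds, d ∈ Submonoid.closure (T : Set ℕ) := by
  induction ds generalizing S with
  | nil =>
    obtain rfl : T = S := h
    exact ⟨hS, hSN, le_rfl, by simp⟩
  | cons d ds ih =>
    obtain ⟨S', h1, h2⟩ := h
    have hins : ∀ x ∈ insert d S, x ∣ N := fun x hx => by
      rcases Finset.mem_insert.1 hx with rfl | hx
      · exact hds _ (by simp)
      · exact hSN x hx
    obtain ⟨k1, k2, k3, k4⟩ := ih h2 h1.2 (h1.dvd hins) fun x hx => hds x (by simp [hx])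
    have hcl := h1.closure_le.trans k3
    refine ⟨k1, k2, (Submonoid.closure_mono ?_).trans hcl, ?_⟩
    · exact Finset.coe_subset.2 (Finset.subset_insert d S)
    · intro x hx
      rcases List.mem_cons.1 hx with rfl | hx
      · exact hcl (Submonoid.subset_closure (by simp))
      · exact k4 x hx

theorem exists_dvd_of_mem_closure {p d : ℕ} {T : Set ℕ} (hp : p.Prime)
    (hd : d ∈ Submonoid.closure T) (hpd : p ∣ d) : ∃ a ∈ T, p ∣ a := by
  induction hd using Submonoid.closure_induction with
  | mem x hx => exact ⟨x, hx, hpd⟩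
  | one => exact absurd (Nat.dvd_one.1 hpd) hp.one_lt.ne'
  | mul x y _ _ hx hy => exact (hp.dvd_mul.1 hpd).elim hx hy

/-- Write `d` as a product of elements of `T`. A factor divisible by `p` shares `p` with `a`, so it
is `a` by coprimality, and `p'` divides it. -/
theorem IsReduced.dvd_of_dvd {p p' a d : ℕ} {T : Finset ℕ} (hT : IsReduced T) (hp : p.Prime)
    (ha : a ∈ T) (hpa : p ∣ a) (hpa' : p' ∣ a) (hd : d ∈ Submonoid.closure (T : Set ℕ))
    (hpd : p ∣ d) : p' ∣ d := by
  induction hd using Submonoid.closure_induction with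
  | mem x hx =>
    by_cases hax : a = x
    · exact hax ▸ hpa'
    · exact absurd (Nat.eq_one_of_dvd_coprimes (hT.1 a ha x hx hax) hpa hpd) hp.one_lt.ne'
  | one => exact absurd (Nat.dvd_one.1 hpd) hp.one_lt.ne'
  | mul x y _ _ hx hy =>
    exact (hp.dvd_mul.1 hpd).elim (fun h => (hx h).mul_right y) fun h => (hy h).mul_left x

theorem dvd_of_mem_reports {N r B d : ℕ} {xs : List ℕ} (hd : d ∈ reports N r B xs) : d ∣ N := by
  simp only [reports, List.mem_flatMap, List.mem_filter, List.mem_map] at hd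
  obtain ⟨x, -, ⟨i, -, rfl⟩, -⟩ := hd
  exact Int.natCast_dvd_natCast.1 (Int.gcd_dvd_right _ _)

/-- If all pairs of prime factors are separated by reported numbers, the factorization is
complete. -/
theorem FactoringRun.eq_primeFactors {N r B : ℕ} {xs : List ℕ} {T : Finset ℕ}
    (h : FactoringRun N r B xs T) (hN : N ≠ 0)
    (hsep : ∀ p ∈ N.primeFactors, ∀ p' ∈ N.primeFactors, p ≠ p' →
      ∃ d ∈ reports N r B xs, ¬ (p ∣ d ↔ p' ∣ d)) : T = N.primeFactors := by
  obtain ⟨S, h1, h2⟩ := h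
  obtain ⟨k1, k2, k3, k4⟩ := h2.final h1.2 (h1.dvd (by simp)) fun d hd => dvd_of_mem_reports hd
  have hNT : N ∈ Submonoid.closure (T : Set ℕ) :=
    k3 (h1.closure_le (Submonoid.subset_closure (by simp)))
  have hprime : ∀ a ∈ T, a.Prime := by
    intro a ha
    have haN := k2 a ha
    have ha0 : a ≠ 0 := fun h => hN (Nat.eq_zero_of_zero_dvd (h ▸ haN))
    -- `1 = 1 ^ 2` counts as a perfect power, so a reduced set does not contain it.
    have ha1 : a ≠ 1 := fun h => k1.2 a ha 1 2 le_rfl (by simpa using h)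
    obtain ⟨p, hp, hpa⟩ := Nat.exists_prime_and_dvd ha1
    have huniq : ∀ {q : ℕ}, q.Prime → q ∣ a → q = p := by
      intro q hq hqa
      by_contra hne
      obtain ⟨d, hd, hnd⟩ := hsep q (Nat.mem_primeFactors.2 ⟨hq, hqa.trans haN, hN⟩) p
        (Nat.mem_primeFactors.2 ⟨hp, hpa.trans haN, hN⟩) hne
      exact hnd ⟨k1.dvd_of_dvd hq ha hqa hpa (k4 d hd), k1.dvd_of_dvd hp ha hpa hqa (k4 d hd)⟩
    -- With a single prime divisor, `a` is a prime power; being neither `1` nor a perfect power, it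
    -- has exponent `1`.
    have hpow := Nat.eq_prime_pow_of_unique_prime_dvd ha0 huniq
    generalize a.primeFactorsList.length = e at hpow
    rcases Nat.lt_or_ge e 2 with he | he
    · interval_cases e
      · exact absurd (by simpa using hpow) ha1
      · rw [pow_one] at hpow
        exact hpow ▸ hp
    · exact absurd hpow (k1.2 a ha p e he)
  ext p
  constructor
  · exact fun hp => Nat.mem_primeFactors.2 ⟨hprime p hp, k2 p hp, hN⟩
  · intro hp
    have hp' := Nat.prime_of_mem_primeFactors hp
    obtain ⟨a, ha, hpa⟩ := exists_dvd_of_mem_closure hp' hNT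
      (Nat.dvd_of_mem_primeFactors hp)
    rwa [(Nat.prime_dvd_prime_iff_eq hp' (hprime a ha)).1 hpa]

/-! ### Uniform probabilities -/

section Uniform
variable {α β : Type*}

theorem uniformProb_nonneg (E : Set α) : 0 ≤ uniformProb E := by
  unfold uniformProb
  positivity

theorem uniformProb_union_le (E F : Set α) :
    uniformProb (E ∪ F) ≤ uniformProb E + uniformProb F := by
  unfold uniformProb
  rw [← add_div]
  gcongr
  exact_mod_cast Set.ncard_union_le E F

theorem uniformProb_biUnion_le {ι : Type*} (s : Finset ι) (E : ι → Set α) :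
    uniformProb (⋃ i ∈ s, E i) ≤ ∑ i ∈ s, uniformProb (E i) := by
  classical
  induction s using Finset.induction_on with
  | empty => simp [uniformProb]
  | insert i s hi ih =>
    rw [Finset.set_biUnion_insert, Finset.sum_insert hi]
    exact (uniformProb_union_le _ _).trans (by gcongr)

theorem uniformProb_prod (E : Set α) (F : Set β) :
    uniformProb (E ×ˢ F) = uniformProb E * uniformProb F := by
  unfold uniformProb
  rw [Set.ncard_prod, Nat.card_prod, Nat.cast_mul, Nat.cast_mul, mul_div_mul_comm]

theorem uniformProb_forall (k : ℕ) (E : Set α) :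
    uniformProb {x : Fin k → α | ∀ j, x j ∈ E} = uniformProb E ^ k := by
  unfold uniformProb
  have h1 : {x : Fin k → α | ∀ j, x j ∈ E}.ncard = E.ncard ^ k := by
    let e : {x : Fin k → α | ∀ j, x j ∈ E} ≃ (Fin k → E) :=
      { toFun := fun x j => ⟨x.1 j, x.2 j⟩
        invFun := fun x => ⟨fun j => x j, fun j => (x j).2⟩
        left_inv := fun _ => rfl
        right_inv := fun _ => rfl }
    rw [← Nat.card_coe_set_eq, ← Nat.card_coe_set_eq E, Nat.card_congr e, Nat.card_fun]
    simp
  rw [h1, Nat.card_fun, div_pow]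
  simp

variable [Finite α] [Finite β]

theorem uniformProb_mono {E F : Set α} (h : E ⊆ F) : uniformProb E ≤ uniformProb F := by
  unfold uniformProb
  gcongr
  exact Set.toFinite F

theorem uniformProb_le_one (E : Set α) : uniformProb E ≤ 1 := by
  unfold uniformProb
  refine div_le_one_of_le₀ ?_ (by positivity)
  exact_mod_cast Set.ncard_le_card E

theorem ncard_setOf_prod (E : α → Set β) :
    {ω : α × β | ω.2 ∈ E ω.1}.ncard = ∑ᶠ a, (E a).ncard := by
  classical
  have := Fintype.ofFinite α
  have := Fintype.ofFinite β
  rw [finsum_eq_sum_of_fintype, ← Nat.card_coe_set_eq]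
  have e : {ω : α × β | ω.2 ∈ E ω.1} ≃ Σ a, E a :=
    { toFun := fun ω => ⟨ω.1.1, ω.1.2, ω.2⟩
      invFun := fun x => ⟨(x.1, x.2.1), x.2.2⟩
      left_inv := fun _ => rfl
      right_inv := fun _ => rfl }
  rw [Nat.card_congr e, Nat.card_sigma]
  rfl

/-- Averaging over the first coordinate. On an empty type `uniformProb` is `0 / 0 = 0`, so these
cases are harmless. -/
theorem uniformProb_prod_le {E : α → Set β} {C : ℝ} (hC : 0 ≤ C)
    (h : ∀ a, uniformProb (E a) ≤ C) : uniformProb {ω : α × β | ω.2 ∈ E ω.1} ≤ C := by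
  have := Fintype.ofFinite α
  rcases isEmpty_or_nonempty α with hα | hα
  · simp [uniformProb, hC]
  rcases isEmpty_or_nonempty β with hβ | hβ
  · simp [uniformProb, hC]
  have hβ0 : (0 : ℝ) < Nat.card β := by exact_mod_cast Nat.card_pos
  have hα0 : (0 : ℝ) < Nat.card α := by exact_mod_cast Nat.card_pos
  rw [uniformProb, ncard_setOf_prod, finsum_eq_sum_of_fintype, Nat.card_prod, Nat.cast_mul,
    div_le_iff₀ (by positivity)]
  push_cast
  calc ∑ a, ((E a).ncard : ℝ) ≤ ∑ _a : α, C * Nat.card β :=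
        Finset.sum_le_sum fun a _ => (div_le_iff₀ hβ0).1 (h a)
    _ = C * (Nat.card α * Nat.card β) := by
      simp [Nat.card_eq_fintype_card]
      ring

/-- All fibres of a surjective homomorphism have the size of the kernel. -/
theorem uniformProb_preimage {G H : Type*} [Group G] [Group H] [Finite G] [Finite H] (f : G →* H)
    (hf : Function.Surjective f) (E : Set H) : uniformProb (f ⁻¹' E) = uniformProb E := by
  classical
  have := Fintype.ofFinite G
  have := Fintype.ofFinite H
  have hfib : ∀ F : Set H, (f ⁻¹' F).ncard = F.ncard * (Finset.univ.filter fun g => f g = 1).card := by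
    intro F
    rw [Set.ncard_eq_toFinset_card' F, Set.ncard_eq_toFinset_card' (f ⁻¹' F),
      Finset.card_eq_sum_card_fiberwise (f := f) (t := F.toFinset) (by intro; simp), Finset.sum_const_nat]
    intro x hx
    rw [← MonoidHom.card_fiber_eq_of_mem_range f (hf x) (hf 1)]
    congr 1
    ext g
    simp only [Finset.mem_filter, Set.mem_toFinset, Set.mem_preimage, Finset.mem_univ, true_and]
    exact ⟨fun h => h.2, fun h => ⟨h ▸ Set.mem_toFinset.1 hx, h⟩⟩
  have h1 := hfib E
  have h2 := hfib Set.univ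
  rw [Set.preimage_univ, Set.ncard_univ, Set.ncard_univ] at h2
  have h3 : 0 < (Finset.univ.filter fun g => f g = 1).card :=
    Finset.card_pos.2 ⟨1, by simp⟩
  have h4 : ((Finset.univ.filter fun g => f g = 1).card : ℝ) ≠ 0 := by exact_mod_cast h3.ne'
  rw [uniformProb, h1, h2, Nat.cast_mul, Nat.cast_mul, mul_div_mul_right _ _ h4, uniformProb]

/-- An injective map that takes `E` into its complement leaves room for two disjoint copies of `E`.
-/
theorem uniformProb_le_half {E : Set α} {f : α → α} (hf : Function.Injective f)
    (h : ∀ x ∈ E, f x ∉ E) : uniformProb E ≤ 1 / 2 := by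
  rcases isEmpty_or_nonempty α with hα | hα
  · simp [uniformProb]
  have hα0 : (0 : ℝ) < Nat.card α := by exact_mod_cast Nat.card_pos
  have h1 : (E ∪ f '' E).ncard = E.ncard + E.ncard := by
    rw [Set.ncard_union_eq, Set.ncard_image_of_injective _ hf]
    rw [Set.disjoint_left]
    rintro _ hx ⟨y, hy, rfl⟩
    exact h y hy hx
  have h2 := Set.ncard_le_card (E ∪ f '' E)
  rw [h1] at h2
  rw [uniformProb, div_le_iff₀ hα0]
  have h3 : (E.ncard : ℝ) + E.ncard ≤ Nat.card α := by exact_mod_cast h2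
  linarith

end Uniform

theorem uniformProb_fst_le {α β : Type*} [Finite β] (E : Set α) :
    uniformProb {ω : α × β | ω.1 ∈ E} ≤ uniformProb E := by
  have : {ω : α × β | ω.1 ∈ E} = E ×ˢ Set.univ := by ext; simp
  rw [this, uniformProb_prod]
  exact mul_le_of_le_one_right (uniformProb_nonneg E) (uniformProb_le_one _)

/-! ### Separation of two prime factors -/

theorem Units.eq_neg_one_of_sq {p : ℕ} [Fact p.Prime] {y : (ZMod p)ˣ} (h : y ^ 2 = 1)
    (h1 : y ≠ 1) : y = -1 := by
  have h2 : (y : ZMod p) * y = 1 := by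
    rw [← pow_two]
    rw [← Units.val_pow_eq_pow_val, h, Units.val_one]
  rcases mul_self_eq_one_iff.1 h2 with h3 | h3
  · exact absurd (Units.ext h3) h1
  · exact Units.ext (by simpa using h3)

theorem neg_one_ne_one_units {p : ℕ} [Fact p.Prime] (hp : 2 < p) : (-1 : (ZMod p)ˣ) ≠ 1 := by
  have : Fact (2 < p) := ⟨hp⟩
  intro h
  exact ZMod.neg_one_ne_one (n := p) (by simpa using congrArg Units.val h)

/-- Let `s` be least with `w ^ (2 ^ s * o) = 1`. If `s = 0`, then `z = -1` works, as `o` is odd and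
`-1 ≠ 1`. Otherwise every `u` with the pattern of `w` has power `-1` at level `s - 1`, being a
square root of `1` other than `1` in a field; the product of two such `u` has power `1` there, so
any one of them serves as `z`. Since `z` depends on `w` only, multiplying by it is injective on
pairs. -/
theorem exists_mul_not_separated {p o t : ℕ} [Fact p.Prime] (hp : 2 < p) (ho : Odd o)
    {H : Type*} [Group H] (w : H) (hw : w ^ (2 ^ t * o) = 1) :
    ∃ z : (ZMod p)ˣ, ∀ u : (ZMod p)ˣ,
      (∀ s ≤ t, u ^ (2 ^ s * o) = 1 ↔ w ^ (2 ^ s * o) = 1) →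
      ¬ ∀ s ≤ t, (z * u) ^ (2 ^ s * o) = 1 ↔ w ^ (2 ^ s * o) = 1 := by
  classical
  have hex : ∃ s, w ^ (2 ^ s * o) = 1 := ⟨t, hw⟩
  have hs := Nat.find_spec hex
  have hst : Nat.find hex ≤ t := Nat.find_min' hex hw
  rcases Nat.eq_zero_or_pos (Nat.find hex) with h0 | hpos
  · rw [h0] at hs
    refine ⟨-1, fun u hu h => ?_⟩
    have h1 := (hu 0 (Nat.zero_le t)).2 hs
    have h2 := (h 0 (Nat.zero_le t)).2 hs
    rw [mul_pow, h1, mul_one, pow_zero, one_mul, ho.neg_one_pow] at h2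
    exact neg_one_ne_one_units hp h2
  · obtain ⟨s, hsucc⟩ := Nat.exists_eq_succ_of_ne_zero hpos.ne'
    have hns : ¬ w ^ (2 ^ s * o) = 1 := Nat.find_min hex (by omega)
    rw [hsucc] at hs hst
    have key : ∀ u : (ZMod p)ˣ, (∀ s ≤ t, u ^ (2 ^ s * o) = 1 ↔ w ^ (2 ^ s * o) = 1) →
        u ^ (2 ^ s * o) = -1 := fun u hu => by
      refine Units.eq_neg_one_of_sq ?_ fun h => hns ((hu s (by omega)).1 h)
      rw [← pow_mul]
      have := (hu (s + 1) hst).2 hs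
      rwa [pow_succ, mul_right_comm] at this
    by_cases hD : ∃ u₀ : (ZMod p)ˣ, ∀ s ≤ t, u₀ ^ (2 ^ s * o) = 1 ↔ w ^ (2 ^ s * o) = 1
    · obtain ⟨u₀, hu₀⟩ := hD
      refine ⟨u₀, fun u hu h => hns ((h s (by omega)).1 ?_)⟩
      rw [mul_pow, key u hu, key u₀ hu₀]
      simp
    -- No unit has the pattern of `w`, so the claim is vacuous.
    · exact ⟨1, fun u hu => absurd ⟨u, hu⟩ hD⟩

/-- The pairs that the powers with the exponents `2 ^ s * o`, `s ≤ t`, do not tell apart. -/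
def notSeparated (G H : Type*) [Group G] [Group H] (t o : ℕ) : Set (G × H) :=
  {u | ∀ s ≤ t, u.1 ^ (2 ^ s * o) = 1 ↔ u.2 ^ (2 ^ s * o) = 1}

/-- Only the factor `H` needs an exponent dividing `2 ^ t * o`; nothing is assumed on orders modulo
`p`. This is why one good prime of the pair is enough. -/
theorem uniformProb_notSeparated_le {p o t : ℕ} [Fact p.Prime] (hp : 2 < p) (ho : Odd o)
    {H : Type*} [Group H] [Finite H] (hH : ∀ w : H, w ^ (2 ^ t * o) = 1) :
    uniformProb (notSeparated (ZMod p)ˣ H t o) ≤ 1 / 2 := by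
  choose z hz using fun w => exists_mul_not_separated hp ho w (hH w)
  refine uniformProb_le_half (f := fun u => (z u.2 * u.1, u.2)) ?_ ?_
  · rintro ⟨u, w⟩ ⟨u', w'⟩ h
    simp only [Prod.mk.injEq] at h
    obtain ⟨h1, rfl⟩ := h
    rw [mul_left_cancel h1]
  · rintro ⟨u, w⟩ hu
    exact hz w u hu

theorem uniformProb_notSeparated_le' {p o t : ℕ} [Fact p.Prime] (hp : 2 < p) (ho : Odd o)
    {H : Type*} [Group H] [Finite H] (hH : ∀ w : H, w ^ (2 ^ t * o) = 1) :
    uniformProb (notSeparated H (ZMod p)ˣ t o) ≤ 1 / 2 := by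
  choose z hz using fun w => exists_mul_not_separated hp ho w (hH w)
  refine uniformProb_le_half (f := fun u => (u.1, z u.1 * u.2)) ?_ ?_
  · rintro ⟨w, u⟩ ⟨w', u'⟩ h
    simp only [Prod.mk.injEq] at h
    obtain ⟨rfl, h1⟩ := h
    rw [mul_left_cancel h1]
  · rintro ⟨w, u⟩ hu h
    exact hz w u (fun s hs => (hu s hs).symm) fun s hs => (h s hs).symm

/-- The reductions of a unit modulo two divisors. -/
def reductions {N p p' : ℕ} (hp : p ∣ N) (hp' : p' ∣ N) : (ZMod N)ˣ →* (ZMod p)ˣ × (ZMod p')ˣ :=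
  (ZMod.unitsMap hp).prod (ZMod.unitsMap hp')

/-- The Chinese remainder theorem gives a unit modulo `p * p'`, and units lift from a divisor to
`N`. -/
theorem reductions_surjective {N p p' : ℕ} (hN : N ≠ 0) (hp : p ∣ N) (hp' : p' ∣ N)
    (hpp : p.Coprime p') : Function.Surjective (reductions hp hp') := by
  have : NeZero N := ⟨hN⟩
  have : NeZero p := ⟨fun h => hN (Nat.eq_zero_of_zero_dvd (h ▸ hp))⟩
  have : NeZero p' := ⟨fun h => hN (Nat.eq_zero_of_zero_dvd (h ▸ hp'))⟩
  rintro ⟨u, w⟩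
  obtain ⟨z, hz1, hz2⟩ := Nat.chineseRemainder hpp (u : ZMod p).val (w : ZMod p').val
  have hzu : (z : ZMod p) = u := by
    rw [(ZMod.natCast_eq_natCast_iff _ _ _).2 hz1, ZMod.natCast_zmod_val]
  have hzw : (z : ZMod p') = w := by
    rw [(ZMod.natCast_eq_natCast_iff _ _ _).2 hz2, ZMod.natCast_zmod_val]
  have hc : z.Coprime (p * p') := by
    refine Nat.Coprime.mul_right ?_ ?_
    · exact (ZMod.isUnit_iff_coprime z p).1 (hzu ▸ u.isUnit)
    · exact (ZMod.isUnit_iff_coprime z p').1 (hzw ▸ w.isUnit)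
  have hdvd : p * p' ∣ N := hpp.mul_dvd_of_dvd_of_dvd hp hp'
  obtain ⟨g, hg⟩ := ZMod.unitsMap_surjective hdvd (ZMod.unitOfCoprime z hc)
  refine ⟨g, Prod.ext ?_ ?_⟩
  · have h1 : ZMod.unitsMap hp g = ZMod.unitsMap (Dvd.intro _ rfl : p ∣ p * p')
        (ZMod.unitsMap hdvd g) := by
      rw [← MonoidHom.comp_apply, ZMod.unitsMap_comp]
    show ZMod.unitsMap hp g = u
    rw [h1, hg]
    apply Units.ext
    simp [ZMod.unitsMap_def, hzu]
  · have h1 : ZMod.unitsMap hp' g = ZMod.unitsMap (Dvd.intro_left _ rfl : p' ∣ p * p')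
        (ZMod.unitsMap hdvd g) := by
      rw [← MonoidHom.comp_apply, ZMod.unitsMap_comp]
    show ZMod.unitsMap hp' g = w
    rw [h1, hg]
    apply Units.ext
    simp [ZMod.unitsMap_def, hzw]

theorem dvd_trialGcd_iff {N p o i : ℕ} [NeZero N] (hp : p ∣ N) (x : (ZMod N)ˣ) :
    p ∣ trialGcd N o (x : ZMod N).val i ↔ (ZMod.unitsMap hp x) ^ (2 ^ i * o) = 1 := by
  have h1 : p ∣ trialGcd N o (x : ZMod N).val i ↔
      (p : ℤ) ∣ ((x : ZMod N).val : ℤ) ^ (2 ^ i * o) - 1 := by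
    rw [trialGcd, ← Int.natCast_dvd_natCast, Int.dvd_coe_gcd_iff]
    exact and_iff_left (Int.natCast_dvd_natCast.2 hp)
  rw [h1, ← ZMod.intCast_zmod_eq_zero_iff_dvd, Units.ext_iff]
  push_cast
  rw [sub_eq_zero]
  have h2 : (((x : ZMod N).val : ℕ) : ZMod p) = (ZMod.unitsMap hp x : (ZMod p)ˣ) := by
    simp [ZMod.unitsMap_def, ZMod.natCast_val]
  rw [h2]

/-! ### The order of a random element -/

/-- The order of the unit `u` modulo `p` does not show some prime power that exceeds `B` and divides
`p - 1`. -/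
def missedSet (p B : ℕ) : Set (ZMod p)ˣ :=
  {u | ∃ q, q.Prime ∧ q ^ (Nat.log q B + 1) ∣ p - 1 ∧
    u ^ ((p - 1) / q ^ (Nat.log q B + 1)) = 1}

/-- Some prime `q` has a larger exponent in `p - 1` than in `r'`, which exceeds that in the order of
`u` by at least `Nat.log q B`. So `q ^ (Nat.log q B + 1)` divides the cofactor of the order in `p -
1`. -/
theorem mem_missedSet {p r B : ℕ} [Fact p.Prime] (hr : r ≠ 0) {u : (ZMod p)ˣ} (hu : orderOf u ∣ r)
    (h : ¬ p - 1 ∣ grownOrder r B) : u ∈ missedSet p B := by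
  have hp1 : p - 1 ≠ 0 := by
    have := (Fact.out : p.Prime).two_le
    omega
  rw [← Nat.factorization_prime_le_iff_dvd hp1 (grownOrder_ne_zero hr B)] at h
  push Not at h
  obtain ⟨q, hq, hlt⟩ := h
  rw [factorization_grownOrder hq hr] at hlt
  have hup : orderOf u ∣ p - 1 := orderOf_dvd_of_pow_eq_one (ZMod.units_pow_card_sub_one_eq_one p u)
  have hu0 : orderOf u ≠ 0 := (orderOf_pos u).ne'
  have hur : (orderOf u).factorization q ≤ r.factorization q :=
    (Nat.factorization_prime_le_iff_dvd hu0 hr).2 hu q hq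
  obtain ⟨c, hc⟩ := hup
  have hc0 : c ≠ 0 := by
    rintro rfl
    exact hp1 (by simpa using hc)
  have hfac : (p - 1).factorization q = (orderOf u).factorization q + c.factorization q := by
    rw [hc, Nat.factorization_mul hu0 hc0, Finsupp.add_apply]
  have hqc : q ^ (Nat.log q B + 1) ∣ c :=
    (hq.pow_dvd_iff_le_factorization hc0).2 (by omega)
  obtain ⟨e, he⟩ := hqc
  have hq0 : 0 < q ^ (Nat.log q B + 1) := pow_pos hq.pos _
  have hpe : p - 1 = q ^ (Nat.log q B + 1) * (orderOf u * e) := by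
    rw [hc, he]
    ring
  refine ⟨q, hq, ⟨_, hpe⟩, ?_⟩
  rw [hpe, Nat.mul_div_cancel_left _ hq0, pow_mul, pow_orderOf_eq_one, one_pow]

/-- The units modulo `p` are cyclic of order `p - 1`, so for `Q = q ^ (Nat.log q B + 1)` at most a
fraction `1 / Q` of them is killed by `(p - 1) / Q`. The relevant `Q` are coprime, exceed `M`, and
have a product dividing `p - 1`, so their number is at most `log p / log M`. -/
theorem uniformProb_missedSet_le {p B : ℕ} {M : ℝ} [Fact p.Prime] (hM : 1 < M)
    (hB : B = ⌊M⌋₊) : uniformProb (missedSet p B) ≤ Real.logb 2 p / (M * Real.logb 2 M) := by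
  classical
  have hp := (Fact.out : p.Prime)
  have hp2 := hp.two_le
  set n := p - 1 with hn
  have hn0 : 0 < n := by omega
  set Qs := n.primeFactors.filter fun q => q ^ (Nat.log q B + 1) ∣ n with hQs
  have hMQ : ∀ q ∈ Qs, M < (q ^ (Nat.log q B + 1) : ℕ) := by
    intro q hq
    have hq' := Nat.prime_of_mem_primeFactors (Finset.mem_filter.1 hq).1
    -- An integer above `⌊M⌋` also exceeds the real number `M`.
    have h1 := Nat.lt_pow_succ_log_self hq'.one_lt B
    calc M < (B : ℝ) + 1 := hB ▸ Nat.lt_floor_add_one M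
      _ ≤ (q ^ (Nat.log q B + 1) : ℕ) := by exact_mod_cast h1
  have hone : ∀ q ∈ Qs, uniformProb {u : (ZMod p)ˣ | u ^ (n / q ^ (Nat.log q B + 1)) = 1} ≤ 1 / M := by
    intro q hq
    have hdvd := (Finset.mem_filter.1 hq).2
    have hq' := Nat.prime_of_mem_primeFactors (Finset.mem_filter.1 hq).1
    have hQ0 : 0 < q ^ (Nat.log q B + 1) := pow_pos hq'.pos _
    have hpos : 0 < n / q ^ (Nat.log q B + 1) := Nat.div_pos (Nat.le_of_dvd hn0 hdvd) hQ0
    have h1 := IsCyclic.card_pow_eq_one_le (α := (ZMod p)ˣ) hpos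
    have h2 : {u : (ZMod p)ˣ | u ^ (n / q ^ (Nat.log q B + 1)) = 1}.ncard ≤
        n / q ^ (Nat.log q B + 1) := by
      rw [Set.ncard_eq_toFinset_card']
      convert h1
      ext
      simp
    have h3 : Nat.card (ZMod p)ˣ = n := by
      rw [Nat.card_eq_fintype_card, ZMod.card_units]
    rw [uniformProb, h3]
    have hn0' : (0 : ℝ) < n := by exact_mod_cast hn0
    rw [div_le_div_iff₀ hn0' (by linarith), one_mul]
    calc _ ≤ ((n / q ^ (Nat.log q B + 1) : ℕ) : ℝ) * (q ^ (Nat.log q B + 1) : ℕ) := by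
          gcongr
          exact (hMQ q hq).le
      _ = n := by exact_mod_cast Nat.div_mul_cancel hdvd
  have hsub : missedSet p B ⊆ ⋃ q ∈ Qs, {u : (ZMod p)ˣ | u ^ (n / q ^ (Nat.log q B + 1)) = 1} := by
    rintro u ⟨q, hq, hdvd, hu⟩
    simp only [Set.mem_iUnion]
    refine ⟨q, Finset.mem_filter.2 ⟨Nat.mem_primeFactors.2 ⟨hq, ?_, hn0.ne'⟩, hdvd⟩, hu⟩
    exact (dvd_pow_self q (by omega)).trans hdvd
  have hprod : ∏ q ∈ Qs, q ^ (Nat.log q B + 1) ∣ n := by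
    refine Finset.prod_dvd_of_isRelPrime ?_ fun q hq => (Finset.mem_filter.1 hq).2
    intro q hq q' hq' hne
    exact Nat.coprime_iff_isRelPrime.1 (Nat.coprime_pow_primes _ _
      (Nat.prime_of_mem_primeFactors (Finset.mem_filter.1 hq).1)
      (Nat.prime_of_mem_primeFactors (Finset.mem_filter.1 hq').1) hne)
  have hpow : M ^ Qs.card ≤ p := by
    calc M ^ Qs.card = ∏ _q ∈ Qs, M := by simp
      _ ≤ ∏ q ∈ Qs, ((q ^ (Nat.log q B + 1) : ℕ) : ℝ) :=
        Finset.prod_le_prod (fun _ _ => by linarith) fun q hq => (hMQ q hq).le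
      _ = ((∏ q ∈ Qs, q ^ (Nat.log q B + 1) : ℕ) : ℝ) := by push_cast; rfl
      _ ≤ p := by exact_mod_cast (Nat.le_of_dvd hn0 hprod).trans (by omega)
  have hlogM : 0 < Real.logb 2 M := Real.logb_pos (by norm_num) hM
  have hcard : Qs.card * Real.logb 2 M ≤ Real.logb 2 p := by
    rw [← Real.logb_pow]
    exact Real.logb_le_logb_of_le (by norm_num) (by positivity) hpow
  calc _ ≤ _ := uniformProb_mono hsub
    _ ≤ ∑ q ∈ Qs, 1 / M := (uniformProb_biUnion_le _ _).trans (Finset.sum_le_sum hone)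
    _ = Qs.card / M := by simp [div_eq_mul_inv]
    _ ≤ _ := by
      rw [div_le_div_iff₀ (by linarith) (by positivity)]
      nlinarith

/-! ### The probability of failure -/

/-- Counting unordered instead of ordered pairs is the source of the `2` in the denominator of the
error term. -/
theorem sum_lt_mul_le (s : Finset ℕ) (f : ℕ → ℝ) :
    2 * ∑ x ∈ (s ×ˢ s).filter (fun x => x.1 < x.2), f x.1 * f x.2 ≤ (∑ p ∈ s, f p) ^ 2 := by
  have h1 : ∑ x ∈ (s ×ˢ s).filter (fun x => x.2 < x.1), f x.1 * f x.2 =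
      ∑ x ∈ (s ×ˢ s).filter (fun x => x.1 < x.2), f x.1 * f x.2 := by
    refine Finset.sum_nbij' Prod.swap Prod.swap ?_ ?_ ?_ ?_ ?_
    · simp +contextual
    · simp +contextual
    · simp
    · simp
    · simp [mul_comm]
  have h2 : (∑ p ∈ s, f p) ^ 2 = ∑ x ∈ s ×ˢ s, f x.1 * f x.2 := by
    rw [pow_two, Finset.sum_mul_sum, Finset.sum_product]
  have h3 : ∑ x ∈ s ×ˢ s, f x.1 * f x.2 =
      ∑ x ∈ (s ×ˢ s).filter (fun x => x.1 < x.2), f x.1 * f x.2 +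
      (∑ x ∈ (s ×ˢ s).filter (fun x => x.2 < x.1), f x.1 * f x.2 +
      ∑ x ∈ (s ×ˢ s).filter (fun x => x.1 = x.2), f x.1 * f x.2) := by
    simp only [Finset.sum_filter, ← Finset.sum_add_distrib]
    refine Finset.sum_congr rfl fun x _ => ?_
    rcases lt_trichotomy x.1 x.2 with h | h | h
    · simp [h, h.ne, h.not_gt]
    · simp [h]
    · simp [h, h.ne', h.not_gt]
  have h4 : 0 ≤ ∑ x ∈ (s ×ˢ s).filter (fun x => x.1 = x.2), f x.1 * f x.2 :=
    Finset.sum_nonneg fun x hx => by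
      rw [(Finset.mem_filter.1 hx).2]
      exact mul_self_nonneg _
  rw [h2, h3, h1]
  linarith

theorem card_filter_lt (s : Finset ℕ) :
    ((s ×ˢ s).filter (fun x => x.1 < x.2)).card = s.card.choose 2 := by
  have h1 : ((s ×ˢ s).filter (fun x => x.2 < x.1)).card =
      ((s ×ˢ s).filter (fun x => x.1 < x.2)).card := by
    refine Finset.card_nbij' Prod.swap Prod.swap ?_ ?_ ?_ ?_
    · intro x; simp +contextual
    · intro x; simp +contextual
    · intro x _; rfl
    · intro x _; rfl
  have h2 : s.offDiag = (s ×ˢ s).filter (fun x => x.1 < x.2) ∪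
      (s ×ˢ s).filter (fun x => x.2 < x.1) := by
    ext x
    simp only [Finset.mem_offDiag, Finset.mem_union, Finset.mem_filter, Finset.mem_product,
      ne_iff_lt_or_gt]
    tauto
  have h3 : Disjoint ((s ×ˢ s).filter (fun x => x.1 < x.2))
      ((s ×ˢ s).filter (fun x => x.2 < x.1)) := by
    rw [Finset.disjoint_left]
    intro x
    simp only [Finset.mem_filter]
    omega
  have h4 := Finset.offDiag_card s
  rw [h2, Finset.card_union_of_disjoint h3, h1] at h4
  rw [Nat.choose_two_right, Nat.mul_sub, mul_one]
  omega

theorem oddPart_spec {a : ℕ} (ha : a ≠ 0) : Odd (oddPart a) ∧ 2 ^ twoExponent a * oddPart a = a := by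
  obtain ⟨t, o, ho, h⟩ := Nat.exists_eq_two_pow_mul_odd ha
  obtain ⟨h1, h2⟩ := oddPart_twoExponent ho (show o * 2 ^ t = a by rw [h, mul_comm])
  rw [h1, h2]
  exact ⟨ho, h.symm⟩

theorem uniformProb_notSeparated_le_of_dvd {p p' a : ℕ} [Fact p.Prime] [Fact p'.Prime] (hp : 2 < p)
    (hp' : 2 < p') (ha : a ≠ 0) (h : p - 1 ∣ a ∨ p' - 1 ∣ a) :
    uniformProb (notSeparated (ZMod p)ˣ (ZMod p')ˣ (twoExponent a) (oddPart a)) ≤ 1 / 2 := by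
  obtain ⟨ho, ha'⟩ := oddPart_spec ha
  have key : ∀ {q : ℕ} [Fact q.Prime], q - 1 ∣ a → ∀ w : (ZMod q)ˣ,
      w ^ (2 ^ twoExponent a * oddPart a) = 1 := by
    rintro q _ ⟨e, he⟩ w
    rw [ha', he, pow_mul, ZMod.units_pow_card_sub_one_eq_one, one_pow]
  rcases h with h | h
  · exact uniformProb_notSeparated_le' hp' ho (key h)
  · exact uniformProb_notSeparated_le hp ho (key h)

/-- The choices for which no trial separates the prime factors `p` and `p'`. -/
def pairFailure (N B k : ℕ) {p p' : ℕ} (hp : p ∣ N) (hp' : p' ∣ N) :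
    Set ((ZMod N)ˣ × (Fin k → (ZMod N)ˣ)) :=
  {ω | ∀ j, reductions hp hp' (ω.2 j) ∈ notSeparated (ZMod p)ˣ (ZMod p')ˣ
    (twoExponent (grownOrder (orderOf ω.1) B)) (oddPart (grownOrder (orderOf ω.1) B))}

/-- Condition on `g`. The set `A` where the order misses a prime power for both `p` and `p'` has
product probability. Outside it `p - 1` or `p' - 1` divides `r'`, and the `k` independent trials
fail with probability at most `1 / 2` each. -/
theorem uniformProb_pairFailure_le {N B k p p' : ℕ} {M : ℝ} (hN : Odd N) (hp : p.Prime)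
    (hp' : p'.Prime) (hpp : p ≠ p') (hpN : p ∣ N) (hpN' : p' ∣ N) (hM : 1 < M) (hB : B = ⌊M⌋₊) :
    uniformProb (pairFailure N B k hpN hpN') ≤ (1 / 2) ^ k +
      Real.logb 2 p / (M * Real.logb 2 M) * (Real.logb 2 p' / (M * Real.logb 2 M)) := by
  classical
  have hN0 : N ≠ 0 := by rintro rfl; simp at hN
  have : NeZero N := ⟨hN0⟩
  have : Fact p.Prime := ⟨hp⟩
  have : Fact p'.Prime := ⟨hp'⟩
  have hgt : ∀ {q : ℕ}, q.Prime → q ∣ N → 2 < q := fun {q} hq hqN => by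
    rcases hq.two_le.lt_or_eq with h | h
    · exact h
    · exact absurd (even_iff_two_dvd.2 (h ▸ hqN)) (Nat.not_even_iff_odd.2 hN)
  have hsurj := reductions_surjective hN0 hpN hpN' ((Nat.coprime_primes hp hp').2 hpp)
  set φ := reductions hpN hpN' with hφ
  set A : Set (ZMod N)ˣ := φ ⁻¹' (missedSet p B ×ˢ missedSet p' B) with hA
  -- The set over `g ∈ A` is emptied, so that one bound holds for every `g`.
  set E : (ZMod N)ˣ → Set (Fin k → (ZMod N)ˣ) := fun g => if g ∈ A then ∅ else
    {x | ∀ j, x j ∈ φ ⁻¹' notSeparated (ZMod p)ˣ (ZMod p')ˣ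
      (twoExponent (grownOrder (orderOf g) B)) (oddPart (grownOrder (orderOf g) B))} with hE
  have hsub : pairFailure N B k hpN hpN' ⊆ {ω | ω.2 ∈ E ω.1} ∪ {ω | ω.1 ∈ A} := by
    intro ω hω
    by_cases hωA : ω.1 ∈ A
    · exact Or.inr hωA
    · left
      simp only [hE, Set.mem_ofPred_eq, if_neg hωA]
      exact hω
  have hEle : ∀ g, uniformProb (E g) ≤ (1 / 2) ^ k := by
    intro g
    by_cases hg : g ∈ A
    · simp only [hE, if_pos hg]
      simp [uniformProb]
    · simp only [hE, if_neg hg]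
      rw [uniformProb_forall, uniformProb_preimage φ hsurj]
      refine pow_le_pow_left₀ (uniformProb_nonneg _) ?_ k
      have hr : orderOf g ≠ 0 := (orderOf_pos g).ne'
      refine uniformProb_notSeparated_le_of_dvd (hgt hp hpN) (hgt hp' hpN')
        (grownOrder_ne_zero hr B) ?_
      by_contra hcon
      rw [not_or] at hcon
      exact hg ⟨mem_missedSet hr (orderOf_map_dvd (ZMod.unitsMap hpN) g) hcon.1,
        mem_missedSet hr (orderOf_map_dvd (ZMod.unitsMap hpN') g) hcon.2⟩
  have hAle : uniformProb A ≤
      Real.logb 2 p / (M * Real.logb 2 M) * (Real.logb 2 p' / (M * Real.logb 2 M)) := by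
    rw [hA, uniformProb_preimage φ hsurj, uniformProb_prod]
    have hlogM : 0 < Real.logb 2 M := Real.logb_pos (by norm_num) hM
    have hlogp : 0 < Real.logb 2 p :=
      Real.logb_pos (by norm_num) (by exact_mod_cast hp.one_lt)
    exact mul_le_mul (uniformProb_missedSet_le hM hB) (uniformProb_missedSet_le hM hB)
      (uniformProb_nonneg _) (by positivity)
  calc _ ≤ _ := uniformProb_mono hsub
    _ ≤ _ := uniformProb_union_le _ _
    _ ≤ _ := add_le_add (uniformProb_prod_le (by positivity) hEle)
      ((uniformProb_fst_le A).trans hAle)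

/-- Discarding trivial gcds costs nothing: neither `1` nor `N` separates two prime factors. -/
theorem exists_mem_pairFailure {N B k : ℕ} {T : Finset ℕ} (hN : N ≠ 0)
    (ω : (ZMod N)ˣ × (Fin k → (ZMod N)ˣ))
    (hT : FactoringRun N (orderOf ω.1) B (representatives ω.2) T) (hne : T ≠ N.primeFactors) :
    ∃ (p p' : ℕ) (hp : p ∈ N.primeFactors) (hp' : p' ∈ N.primeFactors), p < p' ∧
      ω ∈ pairFailure N B k (Nat.dvd_of_mem_primeFactors hp) (Nat.dvd_of_mem_primeFactors hp') := by
  have : NeZero N := ⟨hN⟩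
  have key : ∀ {p p' : ℕ} (hp : p ∈ N.primeFactors) (hp' : p' ∈ N.primeFactors),
      (∀ d ∈ reports N (orderOf ω.1) B (representatives ω.2), p ∣ d ↔ p' ∣ d) →
      ω ∈ pairFailure N B k (Nat.dvd_of_mem_primeFactors hp) (Nat.dvd_of_mem_primeFactors hp') := by
    intro p p' hp hp' h j s hs
    show (ZMod.unitsMap _ (ω.2 j)) ^ _ = 1 ↔ (ZMod.unitsMap _ (ω.2 j)) ^ _ = 1
    rw [← dvd_trialGcd_iff, ← dvd_trialGcd_iff]
    set d := trialGcd N (oddPart (grownOrder (orderOf ω.1) B)) (ω.2 j : ZMod N).val s with hd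
    have hdN : d ∣ N := Int.natCast_dvd_natCast.1 (Int.gcd_dvd_right _ _)
    by_cases h1 : 1 < d ∧ d < N
    · apply h
      simp only [reports, List.mem_flatMap, List.mem_filter, List.mem_map, List.mem_range]
      refine ⟨(ω.2 j : ZMod N).val, ?_, ⟨s, by omega, hd.symm⟩, by simpa using h1⟩
      rw [representatives, List.mem_ofFn]
      exact ⟨j, rfl⟩
    · have hdle := Nat.le_of_dvd (Nat.pos_of_ne_zero hN) hdN
      have hd0 : 0 < d := Nat.pos_of_dvd_of_pos hdN (Nat.pos_of_ne_zero hN)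
      rcases (by omega : d = 1 ∨ d = N) with h2 | h2
      · rw [h2, Nat.dvd_one, Nat.dvd_one]
        have := (Nat.prime_of_mem_primeFactors hp).one_lt
        have := (Nat.prime_of_mem_primeFactors hp').one_lt
        omega
      · rw [h2]
        exact iff_of_true (Nat.dvd_of_mem_primeFactors hp) (Nat.dvd_of_mem_primeFactors hp')
  by_contra hcon
  refine hne (hT.eq_primeFactors hN fun p hp p' hp' hpp => ?_)
  by_contra hnd
  push Not at hnd
  rcases lt_or_gt_of_ne hpp with hlt | hlt
  · exact hcon ⟨p, p', hp, hp', hlt, key hp hp' fun d hd => hnd d hd⟩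
  · exact hcon ⟨p', p, hp', hp, hlt, key hp' hp fun d hd => (hnd d hd).symm⟩

/-- Union bound over the pairs `p < p'`. -/
theorem uniformProb_failure_le {N k : ℕ} {c : ℝ} (hc : 1 ≤ c) (hN : Odd N) (hN4 : 4 ≤ N.size) :
    uniformProb {ω : (ZMod N)ˣ × (Fin k → (ZMod N)ˣ) |
        ∃ T : Finset ℕ, FactoringRun N (orderOf ω.1) ⌊c * (Nat.size N : ℝ)⌋₊
          (representatives ω.2) T ∧ T ≠ N.primeFactors} ≤
      (1 / 2 : ℝ) ^ k * (N.primeFactors.card.choose 2 : ℝ) +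
        1 / (2 * c ^ 2 * Real.logb 2 (c * (Nat.size N : ℝ)) ^ 2) := by
  have hN0 : N ≠ 0 := by rintro rfl; simp at hN
  have : NeZero N := ⟨hN0⟩
  have hm : (4 : ℝ) ≤ N.size := by exact_mod_cast hN4
  set M : ℝ := c * N.size with hM
  have hM1 : 1 < M := by nlinarith
  set L := Real.logb 2 M with hL
  have hL0 : 0 < L := Real.logb_pos (by norm_num) hM1
  set P := (N.primeFactors ×ˢ N.primeFactors).filter fun x => x.1 < x.2 with hP
  set W : ℕ × ℕ → Set ((ZMod N)ˣ × (Fin k → (ZMod N)ˣ)) := fun x =>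
    {ω | ∃ (h : x.1 ∣ N) (h' : x.2 ∣ N), ω ∈ pairFailure N ⌊M⌋₊ k h h'} with hW
  set ε : ℕ → ℝ := fun p => Real.logb 2 p / (M * L) with hε
  have hsub : {ω : (ZMod N)ˣ × (Fin k → (ZMod N)ˣ) |
        ∃ T : Finset ℕ, FactoringRun N (orderOf ω.1) ⌊M⌋₊
          (representatives ω.2) T ∧ T ≠ N.primeFactors} ⊆ ⋃ x ∈ P, W x := by
    rintro ω ⟨T, hT, hne⟩
    obtain ⟨p, p', hp, hp', hlt, h⟩ := exists_mem_pairFailure hN0 ω hT hne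
    simp only [Set.mem_iUnion]
    exact ⟨(p, p'), Finset.mem_filter.2 ⟨Finset.mem_product.2 ⟨hp, hp'⟩, hlt⟩, _, _, h⟩
  have hpair : ∀ x ∈ P, uniformProb (W x) ≤ (1 / 2) ^ k + ε x.1 * ε x.2 := by
    rintro ⟨p, p'⟩ hx
    simp only [hP, Finset.mem_filter, Finset.mem_product] at hx
    obtain ⟨⟨hp, hp'⟩, hlt⟩ := hx
    refine (uniformProb_mono ?_).trans (uniformProb_pairFailure_le (k := k) hN
      (Nat.prime_of_mem_primeFactors hp) (Nat.prime_of_mem_primeFactors hp') hlt.ne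
      (Nat.dvd_of_mem_primeFactors hp) (Nat.dvd_of_mem_primeFactors hp') hM1 rfl)
    rintro ω ⟨_, _, h⟩
    exact h
  -- The product of the distinct primes divides `N < 2 ^ m`, so their logarithms add up to at most
  -- `m`, and `m / (M * L) = 1 / (c * L)`.
  have hεsum : ∑ p ∈ N.primeFactors, ε p ≤ 1 / (c * L) := by
    have h1 : ∑ p ∈ N.primeFactors, Real.logb 2 p ≤ N.size := by
      rw [← Real.logb_prod]
      · have h2 : (∏ p ∈ N.primeFactors, (p : ℝ)) ≤ (2 : ℝ) ^ (N.size : ℝ) := by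
          have h3 := Nat.le_of_dvd (Nat.pos_of_ne_zero hN0) (Nat.prod_primeFactors_dvd N)
          have h4 := h3.trans (Nat.lt_size_self N).le
          have h5 : ((∏ p ∈ N.primeFactors, p : ℕ) : ℝ) ≤ ((2 ^ N.size : ℕ) : ℝ) := Nat.cast_le.2 h4
          rw [Real.rpow_natCast]
          simpa using h5
        calc _ ≤ Real.logb 2 ((2 : ℝ) ^ (N.size : ℝ)) := by
              refine Real.logb_le_logb_of_le (by norm_num) ?_ h2
              exact Finset.prod_pos fun p hp => by
                exact_mod_cast (Nat.prime_of_mem_primeFactors hp).pos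
          _ = N.size := Real.logb_rpow (by norm_num) (by norm_num)
      · intro p hp
        exact_mod_cast (Nat.prime_of_mem_primeFactors hp).ne_zero
    rw [hε, ← Finset.sum_div, div_le_div_iff₀ (by positivity) (by positivity), hM]
    nlinarith [mul_le_mul_of_nonneg_right h1 (by positivity : 0 ≤ c * L)]
  have hε0 : 0 ≤ ∑ p ∈ N.primeFactors, ε p := Finset.sum_nonneg fun p hp => by
    have : 0 ≤ Real.logb 2 p := Real.logb_nonneg (by norm_num) (by
      exact_mod_cast (Nat.prime_of_mem_primeFactors hp).one_le)
    positivity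
  have hsum := sum_lt_mul_le N.primeFactors ε
  have hsq := pow_le_pow_left₀ hε0 hεsum 2
  have hfin : (1 / (c * L)) ^ 2 = 2 * (1 / (2 * c ^ 2 * L ^ 2)) := by
    field_simp
  calc _ ≤ _ := uniformProb_mono hsub
    _ ≤ ∑ x ∈ P, ((1 / 2) ^ k + ε x.1 * ε x.2) :=
      (uniformProb_biUnion_le _ _).trans (Finset.sum_le_sum hpair)
    _ = (1 / 2 : ℝ) ^ k * (N.primeFactors.card.choose 2 : ℝ) + ∑ x ∈ P, ε x.1 * ε x.2 := by
      rw [Finset.sum_add_distrib, Finset.sum_const, hP, card_filter_lt, nsmul_eq_mul, mul_comm]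
    _ ≤ _ := by
      gcongr
      linarith

/-- Two distinct odd primes give `N ≥ 9 > 2 ^ 3`. This ensures `log (cm) > 0` and the bound `B ≥ 4`
that the size estimates use. -/
theorem four_le_size {N : ℕ} (hN : Odd N) (h : 2 ≤ N.primeFactors.card) : 4 ≤ N.size := by
  obtain ⟨p, hp, p', hp', hne⟩ := Finset.one_lt_card.1 h
  have hgt : ∀ q ∈ N.primeFactors, 3 ≤ q := fun q hq => by
    have h2 := (Nat.prime_of_mem_primeFactors hq).two_le
    rcases h2.lt_or_eq with h3 | h3
    · exact h3
    · exact absurd (even_iff_two_dvd.2 (h3 ▸ Nat.dvd_of_mem_primeFactors hq))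
        (Nat.not_even_iff_odd.2 hN)
  have hdvd : p * p' ∣ N := Nat.Coprime.mul_dvd_of_dvd_of_dvd
    ((Nat.coprime_primes (Nat.prime_of_mem_primeFactors hp)
      (Nat.prime_of_mem_primeFactors hp')).2 hne)
    (Nat.dvd_of_mem_primeFactors hp) (Nat.dvd_of_mem_primeFactors hp')
  have hle := Nat.le_of_dvd hN.pos hdvd
  have := Nat.mul_le_mul (hgt p hp) (hgt p' hp')
  exact Nat.lt_size.2 (by omega : 2 ^ 3 ≤ N)

/-! ### The polynomial time bound -/

/-- The program makes a run of the algorithm in polynomial time. -/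
theorem exists_factorProg_time_le : ∃ C D : ℕ, ∀ (c : ℝ) (k N : ℕ), 1 ≤ c → 1 ≤ k → 4 ≤ N.size →
    ∀ (g : (ZMod N)ˣ) (x : Fin k → (ZMod N)ˣ),
      FactoringRun N (orderOf g) ⌊c * (Nat.size N : ℝ)⌋₊ (representatives x)
        (factorProg.output N (orderOf g) ⌊c * (Nat.size N : ℝ)⌋₊ (representatives x)) ∧
      (factorProg.time N (orderOf g) ⌊c * (Nat.size N : ℝ)⌋₊ (representatives x) : ℝ) ≤
        C * (c * (Nat.size N : ℝ) * k) ^ D := by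
  have key := @factorProg_good
  generalize factorProg = P at key ⊢
  obtain ⟨C, D, hCD⟩ := P.exists_cost_le
  -- With `Z = 10 * B² * k` and `B * k ≤ y = c * m * k`, one has `Z + 2 ≤ 12 * y ^ 2`; the constants
  -- are those of `C * (12 * y ^ 2) ^ D`.
  refine ⟨C * 12 ^ D, 2 * D, fun c k N hc hk hN4 g x => ?_⟩
  have hN1 : 1 < N := by
    have := Nat.lt_size.1 hN4
    omega
  have : NeZero N := ⟨by omega⟩
  have hm : (4 : ℝ) ≤ N.size := by exact_mod_cast hN4
  have hk' : (1 : ℝ) ≤ k := by exact_mod_cast hk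
  set B := ⌊c * (Nat.size N : ℝ)⌋₊ with hB
  have hBm : N.size ≤ B := Nat.le_floor (by nlinarith)
  have hBc : (B : ℝ) ≤ c * N.size := Nat.floor_le (by positivity)
  have hr : orderOf g ≤ N := by
    have h1 := orderOf_le_card_univ (x := g)
    rw [ZMod.card_units_eq_totient] at h1
    exact h1.trans (Nat.totient_le N)
  have hlen : (representatives x).length = k := by simp [representatives]
  have hxs : ∀ y ∈ representatives x, y < N := by
    intro y hy
    rw [representatives, List.mem_ofFn] at hy
    obtain ⟨j, rfl⟩ := hy
    exact ZMod.val_lt _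
  have hgood := key (Z := 10 * (B * B) * k) hN1 (by omega) hBm (orderOf_pos g) hr hxs
    (Nat.le_mul_of_pos_right _ hk) (by rw [hlen]; exact Nat.le_mul_of_pos_left _ (by
      have : 0 < B * B := Nat.mul_pos (by omega) (by omega)
      omega))
  refine ⟨hgood.sound, ?_⟩
  have hcost := hCD _ _ _ hgood
  set y : ℝ := c * N.size * k with hy
  have hBy : (B : ℝ) * k ≤ y := by
    rw [hy]
    gcongr
  have hB1 : (1 : ℝ) ≤ B := by exact_mod_cast (by omega : 1 ≤ B)
  have hBk : (1 : ℝ) ≤ B * k := by nlinarith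
  have hZ : ((10 * (B * B) * k + 2 : ℕ) : ℝ) ≤ 12 * y ^ 2 := by
    push_cast
    have h1 : ((B : ℝ) * k) ^ 2 ≤ y ^ 2 := pow_le_pow_left₀ (by positivity) hBy 2
    have h2 : (B : ℝ) * B * k ≤ (B * k) ^ 2 := by
      calc (B : ℝ) * B * k = B * B * k * 1 := by ring
        _ ≤ B * B * k * k := by gcongr
        _ = (B * k) ^ 2 := by ring
    nlinarith
  calc (P.time N (orderOf g) B (representatives x) : ℝ)
      ≤ ((C * (10 * (B * B) * k + 2) ^ D : ℕ) : ℝ) := by exact_mod_cast hcost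
    _ = C * ((10 * (B * B) * k + 2 : ℕ) : ℝ) ^ D := by push_cast; ring
    _ ≤ C * (12 * y ^ 2) ^ D := by gcongr
    _ = _ := by
      rw [mul_pow, ← pow_mul]
      push_cast
      ring

end OrderFactoring

theorem mainTheorem1 :
    ∃ (P : OrderFactoring.Prog) (C D : ℕ),
      ∀ (c : ℝ) (k N : ℕ), 1 ≤ c → 1 ≤ k → Odd N → 2 ≤ N.primeFactors.card →
        -- `P` carries out the algorithm, in time polynomial in `m`, `k` and `c`
        (∀ (g : (ZMod N)ˣ) (x : Fin k → (ZMod N)ˣ),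
          OrderFactoring.FactoringRun N (orderOf g) ⌊c * (Nat.size N : ℝ)⌋₊
            (OrderFactoring.representatives x)
            (P.output N (orderOf g) ⌊c * (Nat.size N : ℝ)⌋₊ (OrderFactoring.representatives x)) ∧
          (P.time N (orderOf g) ⌊c * (Nat.size N : ℝ)⌋₊ (OrderFactoring.representatives x) : ℝ) ≤
            C * (c * (Nat.size N : ℝ) * k) ^ D) ∧
        -- the algorithm rarely ends with anything but the set of all prime factors of `N`
        OrderFactoring.uniformProb
            {ω : (ZMod N)ˣ × (Fin k → (ZMod N)ˣ) |
              ∃ T : Finset ℕ,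
                OrderFactoring.FactoringRun N (orderOf ω.1) ⌊c * (Nat.size N : ℝ)⌋₊
                  (OrderFactoring.representatives ω.2) T ∧
                T ≠ N.primeFactors} ≤
          (1 / 2 : ℝ) ^ k * (N.primeFactors.card.choose 2 : ℝ) +
            1 / (2 * c ^ 2 * Real.logb 2 (c * (Nat.size N : ℝ)) ^ 2) := by
  obtain ⟨C, D, h⟩ := OrderFactoring.exists_factorProg_time_le
  refine ⟨OrderFactoring.factorProg, C, D, fun c k N hc hk hN hcard => ?_⟩
  have hN4 := OrderFactoring.four_le_size hN hcard
  exact ⟨h c k N hc hk hN4, OrderFactoring.uniformProb_failure_le hc hN hN4⟩
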